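/- \textbf{Setting.} There are $K\ge 1$ users, and probing one user costs a fraction $\beta\in(0,1]$ of a slot. Let $X$ be a non-negative random variable with $\mathbb E X=1$ and distribution function $F_X$, let $X_1,X_2,\dots$ be independent copies of $X$, and let $r_1,\dots,r_K>0$. Assumption (A1): the achievable rates $R_k(n)$ (user $k=1,\dots,K$, slot $n=1,2,\dots$) are independent, and $R_k(n)$ is distributed as $r_kX$. \textbf{Algorithm 1.} Put $T_k(0)=1$ for all $k$. In slot $n$, sort the users so that $r_{k_1}/T_{k_1}(n-1)\ge\dots\ge r_{k_K}/T_{k_K}(n-1)$ (ties broken by any fixed measurable rule). Probe $k_1,k_2,\dots$ in this order, and stop after the first $j\ge1$ probes such that $j=K$ or $$(1-j\beta)\,w_j\ \ge\ (1-(j+1)\beta)\,\mathbb E\Big[\max\Big(w_j,\tfrac{r_{k_{j+1}}X}{T_{k_{j+1}}(n-1)}\Big)\Big],\qquad w_j=\max_{i\le j}\frac{R_{k_i}(n)}{T_{k_i}(n-1)},$$ where the expectation is over $X$ only. Let $J(n)$ be this $j$. Schedule the probed user with the largest $R_k(n)/T_k(n-1)$ (the first such user in the probing order), and put $T_k(n)=\frac{n-1}{n}T_k(n-1)+\frac1n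 B_k(n)$, where $B_k(n)=(1-J(n)\beta)R_k(n)$ for the scheduled user and $B_k(n)=0$ for the others. Quotients are taken in $[0,\infty]$, with $c/0=\infty$ for $c>0$ and $0/0=0$. \textbf{Thresholds.} Let $J_{\max}=\min(K,\lfloor 1/\beta\rfloor)$. For $0\le j<J_{\max}$ the equation $$v=\Big(\frac1\beta-(j+1)\Big)\int_v^\infty (x-v)\,dF_X(x)$$ has a unique real solution $v_j$; put $v_{J_{\max}}=0$. \textbf{Theorem 4.} Assume (A1), and assume that $F_X$ has no jump at $v_1,\dots,v_{J_{\max}}$ (for example, that $F_X$ is continuous). Then there is a constant $\kappa$ such that almost surely $T_k(n)/r_k\to\kappa$ as $n\to\infty$ for every user $k$, and the scheduling gain of Algorithm 1, i.e. the ratio $\kappa K$ of the limiting throughput $\kappa r_k$ to the throughput $r_k/K$ of round robin scheduling without probing, is $$\kappa K=\sum_{j=1}^{J_{\max}}\Big[F_X(v_{j-1})^{j-1}-F_X(v_j)^j\Big](1-j\beta)\;\mathbb E\Big\{\Big[\max\big([X_1]_0^{v_{j-1}},\dots,[X_{j-1}]_0^{v_{j-1}},X_j\big)\Big]_{v_j}^{\infty}\Big\}.$$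 Here $[Y]_a^b$ denotes a random variable with the law of $Y$ conditioned on $a\le Y\le b$, the variables inside the maximum are independent, and a term whose bracket $[F_X(v_{j-1})^{j-1}-F_X(v_j)^j]$ is $0$ is read as $0$. Moreover, for $1\le j\le J_{\max}$ the factor $F_X(v_{j-1})^{j-1}-F_X(v_j)^j$ is the steady-state probability that exactly $j$ users are probed in a slot: $\Pr\{J(n)=j\}\to F_X(v_{j-1})^{j-1}-F_X(v_j)^j$ as $n\to\infty$. -/

import Mathlib

open MeasureTheory ProbabilityTheory Filter Topology
open scoped ENNReal

noncomputable section

namespace JPSPF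

/-! ### The homogeneous rate assumption -/

/-- The homogeneous rate assumption: `ν` is the common law of the normalized rates (a law on
`[0, ∞)` with mean one), `r k > 0` is the mean rate of user `k`, and the achievable rates
`R n k` (user `k`, slot `n`) are independent over users and slots, `R n k` having the law of
`r k * X` where `X` has law `ν`. -/
structure HomogeneousRates {Ω : Type*} [MeasurableSpace Ω] (P : Measure Ω) {K : ℕ}
    (ν : Measure ℝ) (r : Fin K → ℝ) (R : ℕ → Fin K → Ω → ℝ) : Prop where
  nonneg : ∀ᵐ x ∂ν, 0 ≤ x
  integrable : Integrable (fun x : ℝ => x) ν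
  mean : ∫ x, x ∂ν = 1
  rate_pos : ∀ k, 0 < r k
  measurable : ∀ n k, Measurable (R n k)
  indep : iIndepFun (fun p : ℕ × Fin K => R p.1 p.2) P
  law : ∀ n k, P.map (R n k) = ν.map (fun x => r k * x)

/-! ### The scheduling algorithm

A slot is described by the throughput vector `t` at its beginning and the vector `ρ` of the
achievable rates in it. Throughput-normalized rates are computed in `[0, ∞]`, so that a user with
zero throughput so far and a positive rate has normalized rate `∞`. -/

/-- A way to sort users in descending order (of throughput-normalized mean rates); the rule for
breaking ties is arbitrary, but depends measurably on the values that are sorted. -/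
structure SortingRule {K : ℕ} (ord : (Fin K → ℝ≥0∞) → Equiv.Perm (Fin K)) : Prop where
  antitone : ∀ a, Antitone (a ∘ ord a)
  measurable : ∀ σ, MeasurableSet {a | ord a = σ}

/-- Throughput-normalized rates `ρ k / t k`. -/
def normRate {K : ℕ} (t ρ : Fin K → ℝ) (k : Fin K) : ℝ≥0∞ :=
  ENNReal.ofReal (ρ k) / ENNReal.ofReal (t k)

/-- The largest normalized rate found among the first `j` users in the probing order `π`
(zero if `j = 0`). -/
def best {K : ℕ} (π : Equiv.Perm (Fin K)) (s : Fin K → ℝ≥0∞) (j : ℕ) : ℝ≥0∞ :=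
  (Finset.univ.filter (fun i : Fin K => (i : ℕ) < j)).sup (fun i => s (π i))

/-- The loop condition for ending the probing phase after `j` probes with best normalized rate `w`:
`(1 - (j+1) β) E[w ∨ R_{k_{j+1}} / T_{k_{j+1}}] ≤ (1 - j β) w`. It holds if all users have been
probed, and if another probe would exhaust the slot (`1 ≤ (j+1) β`). The position `j` of the order
`π`, counted from zero, holds the user `k_{j+1}`. -/
def Stops {K : ℕ} (β : ℝ) (ν : Measure ℝ) (r t : Fin K → ℝ) (π : Equiv.Perm (Fin K))
    (j : ℕ) (w : ℝ≥0∞) : Prop :=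
  ∀ h : j < K,
    ENNReal.ofReal (1 - ((j : ℝ) + 1) * β) *
        ∫⁻ x, max w (ENNReal.ofReal (r (π ⟨j, h⟩) * x) / ENNReal.ofReal (t (π ⟨j, h⟩))) ∂ν
      ≤ ENNReal.ofReal (1 - (j : ℝ) * β) * w

/-- The number of users probed in a slot: the first `j ≥ 1` at which the loop ends. -/
def numProbed {K : ℕ} (β : ℝ) (ν : Measure ℝ) (r : Fin K → ℝ)
    (ord : (Fin K → ℝ≥0∞) → Equiv.Perm (Fin K)) (t ρ : Fin K → ℝ) : ℕ :=
  sInf {j : ℕ | 1 ≤ j ∧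
    Stops β ν r t (ord (normRate t r)) j (best (ord (normRate t r)) (normRate t ρ) j)}

/-- User `k` is scheduled: among the probed users it has the largest normalized rate (and it is the
first such user in the probing order). -/
def Scheduled {K : ℕ} (β : ℝ) (ν : Measure ℝ) (r : Fin K → ℝ)
    (ord : (Fin K → ℝ≥0∞) → Equiv.Perm (Fin K)) (t ρ : Fin K → ℝ) (k : Fin K) : Prop :=
  (((ord (normRate t r)).symm k : Fin K) : ℕ) < numProbed β ν r ord t ρ ∧
  normRate t ρ k = best (ord (normRate t r)) (normRate t ρ) (numProbed β ν r ord t ρ) ∧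
  ∀ i : Fin K, i < (ord (normRate t r)).symm k →
    normRate t ρ (ord (normRate t r) i) < normRate t ρ k

open Classical in
/-- The amount of data transmitted to user `k` in a slot, `(1 - J β) R_k I_k`. -/
def served {K : ℕ} (β : ℝ) (ν : Measure ℝ) (r : Fin K → ℝ)
    (ord : (Fin K → ℝ≥0∞) → Equiv.Perm (Fin K)) (t ρ : Fin K → ℝ) (k : Fin K) : ℝ :=
  if Scheduled β ν r ord t ρ k then (1 - (numProbed β ν r ord t ρ : ℝ) * β) * ρ k else 0

/-- The throughputs `T_k(n)` generated by the algorithm from the rates `ρ n k`, `n = 1, 2, …`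
(`ρ 0` is not used). -/
def throughput {K : ℕ} (β : ℝ) (ν : Measure ℝ) (r : Fin K → ℝ)
    (ord : (Fin K → ℝ≥0∞) → Equiv.Perm (Fin K)) (ρ : ℕ → Fin K → ℝ) : ℕ → Fin K → ℝ
  | 0 => fun _ => 1
  | n + 1 => fun k =>
      ((n : ℝ) / ((n : ℝ) + 1)) * throughput β ν r ord ρ n k +
        (1 / ((n : ℝ) + 1)) * served β ν r ord (throughput β ν r ord ρ n) (ρ (n + 1)) k

/-- The number `J(n + 1)` of users probed in slot `n + 1`. -/
def probesInSlot {K : ℕ} (β : ℝ) (ν : Measure ℝ) (r : Fin K → ℝ)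
    (ord : (Fin K → ℝ≥0∞) → Equiv.Perm (Fin K)) (ρ : ℕ → Fin K → ℝ) (n : ℕ) : ℕ :=
  numProbed β ν r ord (throughput β ν r ord ρ n) (ρ (n + 1))

/-! ### The quantities in the formula for the scheduling gain -/

/-- The largest number of users that can be probed in a slot. -/
def Jmax (K : ℕ) (β : ℝ) : ℕ := min K ⌊1 / β⌋₊

/-- `g_j(v) = (1/β - (j+1)) ∫_v^∞ (x - v) dF(x)`. -/
def g (β : ℝ) (ν : Measure ℝ) (j : ℕ) (v : ℝ) : ℝ :=
  (1 / β - ((j : ℝ) + 1)) * ∫ x in Set.Ioi v, (x - v) ∂ν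

/-- The threshold sequence: `v_j` solves `v = g_j(v)` for `j < J_max`, and `v_{J_max} = 0`. -/
def IsThreshold (K : ℕ) (β : ℝ) (ν : Measure ℝ) (v : ℕ → ℝ) : Prop :=
  (∀ j < Jmax K β, v j = g β ν j (v j)) ∧ v (Jmax K β) = 0

/-- The factor `F(v_{j-1})^{j-1} - F(v_j)^j`. -/
def probeProb (ν : Measure ℝ) (v : ℕ → ℝ) (j : ℕ) : ℝ :=
  cdf ν (v (j - 1)) ^ (j - 1) - cdf ν (v j) ^ j

/-- The law of `max([X_1]_0^b, …, [X_{j-1}]_0^b, X_j)`, where `X_1, …, X_j` are independent with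
law `ν`, and the truncation `[X]_a^b` has the law of `X` conditioned on `a ≤ X ≤ b`. -/
def maxLaw (ν : Measure ℝ) (b : ℝ) (j : ℕ) : Measure ℝ :=
  (Measure.pi (fun i : Fin j =>
    if (i : ℕ) + 1 < j then ProbabilityTheory.cond ν (Set.Icc 0 b) else ν)).map
      (fun x : Fin j → ℝ => ⨆ i, x i)

/-- `E [ [max([X_1]_0^b, …, [X_{j-1}]_0^b, X_j)]_a^∞ ]` with `b = v_{j-1}`, `a = v_j`. -/
def truncMaxMean (ν : Measure ℝ) (v : ℕ → ℝ) (j : ℕ) : ℝ :=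
  ∫ m, m ∂(ProbabilityTheory.cond (maxLaw ν (v (j - 1)) j) (Set.Ici (v j)))

end JPSPF

end

/-! # Convergence of the probing scheduler under homogeneous rates

Divide the rates and throughputs by the mean rates `r k`: the normalized rates `x k` are then i.i.d.
with law `ν`, and `τ k = T k / r k` satisfies `n τ(n) = ∑ b`, where `b k` is the normalized service
of user `k` in a slot (`reward`). Let `H k (t)` be the mean of `b k` at throughputs `t`. The service
is dominated by the rates alone, which are i.i.d. and integrable, so truncation together with the
convergence of an `L²`-bounded martingale shows that the averages of `b` and of `H` are almost
surely asymptotically equal (`ae_tendsto_average_sub_integral`). No Lyapunov function or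
differential equation is then needed.

*The throughputs equalize.* If `k` precedes `l` in the probing order, exchanging the rates of `k`
and `l` turns each slot in which `l` is served into one in which `k` is served at least as much,
after no more probes (`reward_le_reward_swap`). The rates being exchangeable, `H l ≤ H k` whenever
`τ k < τ l`. Hence the compensator of `n (τ l - τ k)` always points towards zero, and such a sum is
`o(n)` (`eventually_sum_div_le`): `τ l - τ k → 0`. If `β < 1`, the user served has at least the rate
of the user probed first and a fixed fraction of the slot is left for it, so `∑ H` is bounded below
and so are the `τ k`. Consequently the ratios `τ k / τ l` tend to one (`ae_ratio`).

*The limit.* For positive throughputs the stopping rule is a threshold rule: the algorithm stops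
after `j` probes if and only if the best normalized rate, in units of the mean normalized rate of
the next user, is at least `v j` (`IsThreshold.stops_iff`). When the ratios tend to one, the number
of probes at a fixed rate vector is therefore eventually that of the rule "stop when the best of
the first `j` rates is at least `v j`", unless a rate equals a threshold, which has probability
zero. By dominated convergence `∑ H` and the conditional law of the number of probes converge to
their values for this rule, for each of the finitely many probing orders; so `∑ τ` converges as
well.

*The formula.* The thresholds decrease, so the threshold rule makes exactly `j` probes when the
first `j - 1` rates are below `v (j - 1)` and the best of the first `j` rates reaches `v j`
(`thresholdStop_eq_iff`). The probability of this event is `F(v_{j-1})^(j-1) - F(v_j)^j`, and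
conditioning on it yields the truncated maximum in the formula (`probeProb_mul_truncMaxMean`).

If `β = 1`, the only probe uses up the slot, and all throughputs vanish after the first slot. -/

noncomputable section

namespace JPSPF

/-! ### A law of large numbers for dominated adapted sequences -/

/-- Kronecker's lemma for the weights `j`. -/
theorem tendsto_sum_mul_div_of_tendsto_sum {x : ℕ → ℝ} {s : ℝ}
    (h : Tendsto (fun n => ∑ j ∈ Finset.range n, x j) atTop (𝓝 s)) :
    Tendsto (fun n : ℕ => (∑ j ∈ Finset.range n, (j : ℝ) * x j) / n) atTop (𝓝 0) := by
  have key : ∀ n : ℕ, ∑ j ∈ Finset.range n, (j : ℝ) * x j =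
      n * ∑ j ∈ Finset.range n, x j -
        ∑ i ∈ Finset.range n, ∑ j ∈ Finset.range (i + 1), x j := by
    intro n
    induction n with
    | zero => simp
    | succ n ih =>
      rw [Finset.sum_range_succ, ih, Finset.sum_range_succ (fun i => ∑ j ∈ Finset.range (i + 1), x j),
        Finset.sum_range_succ x]
      push_cast
      ring
  have h2 := (h.comp (tendsto_add_atTop_nat 1)).cesaro
  have h3 := h.sub h2
  rw [sub_self] at h3
  refine h3.congr' ?_
  filter_upwards [eventually_gt_atTop 0] with n hn
  have : (n : ℝ) ≠ 0 := by positivity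
  rw [key]
  simp only [Function.comp]
  field_simp

section Independence

variable {Ω 𝒰 𝒱 : Type*} {m : MeasurableSpace Ω} [m0 : MeasurableSpace Ω] [MeasurableSpace 𝒰]
  [MeasurableSpace 𝒱] {P : Measure Ω} [IsProbabilityMeasure P]

/-- Freezing an independent variable: `E ψ(U, V) = E ψ̄(U)` with `ψ̄ u = E ψ(u, V)`. -/
theorem integral_comp_of_indep (hm : m ≤ m0) {U : Ω → 𝒰} {V : Ω → 𝒱}
    (hU : Measurable[m] U) (hV : Measurable V)
    (hind : Indep m (MeasurableSpace.comap V inferInstance) P) {ψ : 𝒰 → 𝒱 → ℝ}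
    (hψ : Measurable (Function.uncurry ψ)) (hint : Integrable (fun ω => ψ (U ω) (V ω)) P) :
    ∫ ω, ψ (U ω) (V ω) ∂P = ∫ ω, ∫ y, ψ (U ω) y ∂(P.map V) ∂P := by
  have hU' : Measurable U := hU.mono hm le_rfl
  have hi : IndepFun U V P :=
    indep_of_indep_of_le_left hind (measurable_iff_comap_le.mp hU)
  have hprod := (indepFun_iff_map_prod_eq_prod_map_map hU'.aemeasurable hV.aemeasurable).mp hi
  have hUV : Measurable (fun ω => (U ω, V ω)) := hU'.prodMk hV
  have hint' : Integrable (Function.uncurry ψ) ((P.map U).prod (P.map V)) := by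
    rw [← hprod]
    exact (integrable_map_measure hψ.aestronglyMeasurable hUV.aemeasurable).mpr hint
  have := Measure.isProbabilityMeasure_map (μ := P) hV.aemeasurable
  have := Measure.isProbabilityMeasure_map (μ := P) hU'.aemeasurable
  have h1 : ∫ ω, ψ (U ω) (V ω) ∂P = ∫ z, Function.uncurry ψ z ∂((P.map U).prod (P.map V)) := by
    rw [← hprod, integral_map hUV.aemeasurable hψ.aestronglyMeasurable]
    rfl
  rw [h1, integral_prod _ hint', integral_map hU'.aemeasurable]
  · rfl
  · exact hψ.stronglyMeasurable.integral_prod_right.aestronglyMeasurable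

theorem integral_mul_comp_eq_zero_of_indep (hm : m ≤ m0) {U : Ω → 𝒰}
    {V : Ω → 𝒱} (hU : Measurable[m] U) (hV : Measurable V)
    (hind : Indep m (MeasurableSpace.comap V inferInstance) P) {ψ : 𝒰 → 𝒱 → ℝ}
    (hψ : Measurable (Function.uncurry ψ))
    (h0 : ∀ u, ∫ y, ψ u y ∂(P.map V) = 0) {f : Ω → ℝ} (hf : Measurable[m] f)
    (hint' : Integrable (fun ω => f ω * ψ (U ω) (V ω)) P) :
    ∫ ω, f ω * ψ (U ω) (V ω) ∂P = 0 := by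
  have := integral_comp_of_indep (U := fun ω => (f ω, U ω)) (V := V) hm
    (hf.prodMk hU) hV hind (ψ := fun c y => c.1 * ψ c.2 y) (by
      have : Measurable (fun z : (ℝ × 𝒰) × 𝒱 => Function.uncurry ψ (z.1.2, z.2)) := by fun_prop
      exact (measurable_fst.comp measurable_fst).mul this) hint'
  rw [this]
  simp [integral_const_mul, h0]

end Independence

/-- Truncated second moments of an integrable variable grow so slowly that
`∑ j⁻² E[Y²; Y ≤ j]` is bounded. -/
theorem sum_inv_sq_mul_integral_sq_le {𝒱 : Type*} [MeasurableSpace 𝒱] {μ : Measure 𝒱}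
    [IsProbabilityMeasure μ] {D : 𝒱 → ℝ} (hDi : Integrable D μ) (hD0 : 0 ≤ D) (K : ℕ) :
    ∑ j ∈ Finset.range K, ((j : ℝ) ^ 2)⁻¹ * ∫ y, (if D y ≤ j then D y else 0) ^ 2 ∂μ ≤
      2 * ∫ y, D y ∂μ := by
  let _ : MeasureSpace 𝒱 := ⟨μ⟩
  have : IsProbabilityMeasure (volume : Measure 𝒱) := ‹IsProbabilityMeasure μ›
  refine le_trans (le_of_eq ?_) (sum_variance_truncation_le (X := D) hDi hD0 K)
  refine Finset.sum_congr rfl fun j _ => ?_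
  congr 1
  refine integral_congr_ae ?_
  filter_upwards with y
  have h0 := hD0 y
  simp only [Pi.zero_apply] at h0
  simp only [Pi.pow_apply, truncation, Function.comp, Set.indicator, Set.mem_Ioc, id]
  congr 1
  by_cases h : D y ≤ j
  · rcases h0.eq_or_lt with h1 | h1
    · simp [← h1]
    · have : -(j : ℝ) < D y := by
        have : (0 : ℝ) ≤ j := by positivity
        linarith
      simp [h, this]
  · simp [h]

theorem tsum_measure_lt_top {𝒱 : Type*} [MeasurableSpace 𝒱] {μ : Measure 𝒱}
    [IsProbabilityMeasure μ] {D : 𝒱 → ℝ} (hDi : Integrable D μ) (hD0 : 0 ≤ D) :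
    ∑' j : ℕ, μ {y | (j : ℝ) < D y} < ∞ := by
  let _ : MeasureSpace 𝒱 := ⟨μ⟩
  have : IsProbabilityMeasure (volume : Measure 𝒱) := ‹IsProbabilityMeasure μ›
  exact tsum_prob_mem_Ioi_lt_top (X := D) hDi hD0

section LLN

variable {Ω 𝒰 𝒱 : Type*} [m0 : MeasurableSpace Ω] [MeasurableSpace 𝒰] [MeasurableSpace 𝒱]
  {P : Measure Ω} [IsProbabilityMeasure P] {μ : Measure 𝒱}

/-- If the `ψ n` are bounded and centered in their second variable and the variances of the terms
`ψ n (U n) (V (n + 1))` are summable, their partial sums form an `L²`-bounded martingale and so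
converge almost surely. -/
theorem ae_exists_tendsto_sum (ℱ : Filtration ℕ m0) {U : ℕ → Ω → 𝒰} {V : ℕ → Ω → 𝒱}
    (hU : ∀ n, Measurable[ℱ n] (U n)) (hV : ∀ n, Measurable[ℱ n] (V n))
    (hind : ∀ n, Indep (ℱ n) (MeasurableSpace.comap (V (n + 1)) inferInstance) P)
    (hlaw : ∀ n, P.map (V (n + 1)) = μ) {ψ : ℕ → 𝒰 → 𝒱 → ℝ}
    (hψ : ∀ n, Measurable (Function.uncurry (ψ n))) (hψb : ∀ n, ∃ C, ∀ u y, |ψ n u y| ≤ C)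
    (hψ0 : ∀ n u, ∫ y, ψ n u y ∂μ = 0) {S : ℝ}
    (hS : ∀ n, ∑ j ∈ Finset.range n, ∫ ω, (ψ j (U j ω) (V (j + 1) ω)) ^ 2 ∂P ≤ S) :
    ∀ᵐ ω ∂P, ∃ s, Tendsto (fun n => ∑ j ∈ Finset.range n, ψ j (U j ω) (V (j + 1) ω))
      atTop (𝓝 s) := by
  choose C hC using hψb
  set Z : ℕ → Ω → ℝ := fun j ω => ψ j (U j ω) (V (j + 1) ω) with hZ
  set N : ℕ → Ω → ℝ := fun n ω => ∑ j ∈ Finset.range n, Z j ω with hN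
  have hU' : ∀ n, Measurable (U n) := fun n => (hU n).mono (ℱ.le n) le_rfl
  have hV' : ∀ n, Measurable (V n) := fun n => (hV n).mono (ℱ.le n) le_rfl
  have hZm : ∀ j, Measurable (Z j) := fun j => by
    simpa [Function.comp_def] using (hψ j).comp ((hU' j).prodMk (hV' (j + 1)))
  have hZF : ∀ j, Measurable[ℱ (j + 1)] (Z j) := fun j =>
    (hψ j).comp (((hU j).mono (ℱ.mono (Nat.le_succ j)) le_rfl).prodMk (hV (j + 1)))
  have hNF : ∀ n, Measurable[ℱ n] (N n) := fun n =>
    Finset.measurable_fun_sum _ fun j hj =>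
      (hZF j).mono (ℱ.mono (Finset.mem_range.mp hj)) le_rfl
  have hNm : ∀ n, Measurable (N n) := fun n => (hNF n).mono (ℱ.le n) le_rfl
  have hZb : ∀ j ω, |Z j ω| ≤ C j := fun j ω => hC j _ _
  have hNb : ∀ n ω, |N n ω| ≤ ∑ j ∈ Finset.range n, C j := fun n ω =>
    (Finset.abs_sum_le_sum_abs _ _).trans (Finset.sum_le_sum fun j _ => hZb j ω)
  have hbd : ∀ {f : Ω → ℝ} {c : ℝ}, Measurable f → (∀ ω, |f ω| ≤ c) → Integrable f P :=
    fun hf hc => Integrable.of_bound hf.aestronglyMeasurable _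
      (Eventually.of_forall fun ω => by simpa [Real.norm_eq_abs] using hc ω)
  have hZi : ∀ j, Integrable (Z j) P := fun j => hbd (hZm j) (hZb j)
  have hNi : ∀ n, Integrable (N n) P := fun n => hbd (hNm n) (hNb n)
  have horth : ∀ n (f : Ω → ℝ) (c : ℝ), Measurable[ℱ n] f → (∀ ω, |f ω| ≤ c) →
      ∫ ω, f ω * Z n ω ∂P = 0 := by
    intro n f c hf hc
    refine integral_mul_comp_eq_zero_of_indep (ℱ.le n) (hU n) (hV' (n + 1)) (hind n) (hψ n)
      (fun u => by rw [hlaw]; exact hψ0 n u) hf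
      (hbd (c := c * C n) ((hf.mono (ℱ.le n) le_rfl).mul (hZm n)) fun ω => ?_)
    rw [abs_mul]
    exact mul_le_mul (hc ω) (hZb n ω) (abs_nonneg _) ((abs_nonneg _).trans (hc ω))
  have hmart : Martingale N ℱ P := by
    refine martingale_of_setIntegral_eq_succ (fun n => (hNF n).stronglyMeasurable) hNi ?_
    intro n s hs
    have h1 : ∀ ω, N (n + 1) ω = N n ω + Z n ω := fun ω => Finset.sum_range_succ _ _
    have hs' := ℱ.le n s hs
    simp_rw [h1]
    rw [integral_add (hNi n).integrableOn (hZi n).integrableOn]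
    have h2 := horth n (s.indicator fun _ => 1) 1
      ((@measurable_const _ _ _ (ℱ n) (1 : ℝ)).indicator hs)
      (fun ω => by by_cases h : ω ∈ s <;> simp [h])
    have h3 : ∫ ω in s, Z n ω ∂P = 0 := by
      rw [← h2, ← integral_indicator hs']
      congr 1
      ext ω
      by_cases h : ω ∈ s <;> simp [h]
    rw [h3, add_zero]
  have hsq : ∀ n, ∫ ω, (N n ω) ^ 2 ∂P = ∑ j ∈ Finset.range n, ∫ ω, (Z j ω) ^ 2 ∂P := by
    intro n
    induction n with
    | zero => simp [hN]
    | succ n ih =>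
      have h1 : ∀ ω, (N (n + 1) ω) ^ 2 = ((N n ω) ^ 2 + 2 * (N n ω * Z n ω)) + (Z n ω) ^ 2 := by
        intro ω
        have : N (n + 1) ω = N n ω + Z n ω := Finset.sum_range_succ _ _
        rw [this]; ring
      have i1 : Integrable (fun ω => (N n ω) ^ 2) P :=
        hbd ((hNm n).pow_const 2) (c := (∑ j ∈ Finset.range n, C j) ^ 2) fun ω => by
          rw [abs_pow]; exact pow_le_pow_left₀ (abs_nonneg _) (hNb n ω) 2
      have i2 : Integrable (fun ω => 2 * (N n ω * Z n ω)) P :=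
        (hbd ((hNm n).mul (hZm n)) (c := (∑ j ∈ Finset.range n, C j) * C n) fun ω => by
          rw [Pi.mul_apply, abs_mul]
          exact mul_le_mul (hNb n ω) (hZb n ω) (abs_nonneg _)
            ((abs_nonneg _).trans (hNb n ω))).const_mul 2
      have i3 : Integrable (fun ω => (Z n ω) ^ 2) P :=
        hbd ((hZm n).pow_const 2) (c := (C n) ^ 2) fun ω => by
          rw [abs_pow]; exact pow_le_pow_left₀ (abs_nonneg _) (hZb n ω) 2
      simp_rw [h1]
      have i12 : Integrable (fun ω => (N n ω) ^ 2 + 2 * (N n ω * Z n ω)) P := i1.add i2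
      rw [integral_add i12 i3, integral_add i1 i2, integral_const_mul,
        horth n (N n) _ (hNF n) (hNb n), ih, Finset.sum_range_succ]
      ring
  have hL1 : ∀ n, eLpNorm (N n) 1 P ≤ ((1 + S).toNNReal : ℝ≥0∞) := by
    intro n
    rw [eLpNorm_one_eq_lintegral_enorm, ← ofReal_integral_norm_eq_lintegral_enorm (hNi n)]
    refine ENNReal.ofReal_le_ofReal ?_
    have i1 : Integrable (fun ω => (N n ω) ^ 2) P :=
      hbd ((hNm n).pow_const 2) (c := (∑ j ∈ Finset.range n, C j) ^ 2) fun ω => by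
        rw [abs_pow]; exact pow_le_pow_left₀ (abs_nonneg _) (hNb n ω) 2
    have h1 : ∫ ω, ‖N n ω‖ ∂P ≤ ∫ ω, (1 + (N n ω) ^ 2) ∂P := by
      refine integral_mono (hNi n).norm ((integrable_const _).add i1) fun ω => ?_
      simp only [Real.norm_eq_abs]
      nlinarith [sq_abs (N n ω), sq_nonneg (|N n ω| - 1)]
    rw [integral_add (integrable_const _) i1, hsq] at h1
    have := hS n
    simp only [integral_const, probReal_univ, smul_eq_mul, mul_one] at h1
    linarith
  filter_upwards [hmart.submartingale.exists_ae_tendsto_of_bdd hL1] with ω hω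
  exact hω

/-- **Strong law of large numbers for dominated adapted sequences.** If `V (n + 1)` is independent
of the past `ℱ n`, and `φ u y` is dominated by an integrable function of `y` alone, then the
averages of `φ (U j) (V (j + 1))` and those of the conditional means are asymptotically equal.
Only a first moment is available, hence the truncation of the `j`-th term at level `j`. -/
theorem ae_tendsto_average_sub_integral [IsProbabilityMeasure μ] (ℱ : Filtration ℕ m0) {U : ℕ → Ω → 𝒰} {V : ℕ → Ω → 𝒱}
    (hU : ∀ n, Measurable[ℱ n] (U n)) (hV : ∀ n, Measurable[ℱ n] (V n))
    (hind : ∀ n, Indep (ℱ n) (MeasurableSpace.comap (V (n + 1)) inferInstance) P)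
    (hlaw : ∀ n, P.map (V (n + 1)) = μ) {φ : 𝒰 → 𝒱 → ℝ}
    (hφ : Measurable (Function.uncurry φ)) {D : 𝒱 → ℝ} (hD : Measurable D)
    (hDi : Integrable D μ) (hφD : ∀ u y, |φ u y| ≤ D y) :
    ∀ᵐ ω ∂P, Tendsto (fun n : ℕ => (∑ j ∈ Finset.range n,
      (φ (U j ω) (V (j + 1) ω) - ∫ y, φ (U j ω) y ∂μ)) / n) atTop (𝓝 0) := by
  obtain ⟨ω0⟩ : Nonempty Ω := P.nonempty_of_neZero
  have hD0 : 0 ≤ D := fun y => (abs_nonneg _).trans (hφD (U 0 ω0) y)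
  have hV' : ∀ n, Measurable (V n) := fun n => (hV n).mono (ℱ.le n) le_rfl
  have hU' : ∀ n, Measurable (U n) := fun n => (hU n).mono (ℱ.le n) le_rfl
  have hφu : ∀ u, Measurable (φ u) := fun u => hφ.comp measurable_prodMk_left
  have hφi : ∀ u, Integrable (φ u) μ := fun u =>
    hDi.mono' (hφu u).aestronglyMeasurable (Eventually.of_forall fun y => hφD u y)
  -- the truncation at level `j`, before and after centering
  set τ : ℕ → 𝒰 → 𝒱 → ℝ := fun j u y => if D y ≤ j then φ u y else 0 with hτ
  have hτm : ∀ j, Measurable (Function.uncurry (τ j)) := fun j =>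
    Measurable.ite (measurableSet_le (hD.comp measurable_snd) measurable_const) hφ measurable_const
  have hτu : ∀ j u, Measurable (τ j u) := fun j u => (hτm j).comp measurable_prodMk_left
  have hτD : ∀ j u y, |τ j u y| ≤ if D y ≤ j then D y else 0 := by
    intro j u y
    simp only [hτ]
    split_ifs
    · exact hφD u y
    · simp
  have hτj : ∀ j u y, |τ j u y| ≤ j := fun j u y => (hτD j u y).trans (by
    split_ifs with h
    · exact h
    · positivity)
  have hτi : ∀ j u, Integrable (τ j u) μ := fun j u =>
    Integrable.of_bound (hτu j u).aestronglyMeasurable (j : ℝ)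
      (Eventually.of_forall fun y => hτj j u y)
  set ψ : ℕ → 𝒰 → 𝒱 → ℝ := fun j u y => (j : ℝ)⁻¹ * (τ j u y - ∫ z, τ j u z ∂μ) with hψ
  have hτint : ∀ j u, |∫ z, τ j u z ∂μ| ≤ j := fun j u => by
    have := norm_integral_le_of_norm_le_const (μ := μ) (f := τ j u) (C := (j : ℝ))
      (Eventually.of_forall fun y => hτj j u y)
    simpa using this
  have hψm : ∀ j, Measurable (Function.uncurry (ψ j)) := by
    intro j
    have h1 : Measurable (fun u => ∫ z, τ j u z ∂μ) :=
      ((hτm j).stronglyMeasurable.integral_prod_right (ν := μ)).measurable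
    exact ((hτm j).sub (h1.comp measurable_fst)).const_mul _
  have hconv := ae_exists_tendsto_sum (S := 2 * ∫ y, D y ∂μ) ℱ hU hV hind hlaw hψm
    (fun j => ⟨(j : ℝ)⁻¹ * (j + j), fun u y => by
      simp only [hψ]
      rw [abs_mul, abs_of_nonneg (by positivity : (0 : ℝ) ≤ (j : ℝ)⁻¹)]
      refine mul_le_mul_of_nonneg_left ?_ (by positivity)
      exact (abs_sub _ _).trans (add_le_add (hτj j u y) (hτint j u))⟩)
    (fun j u => by
      simp only [hψ]
      rw [integral_const_mul, integral_sub (hτi j u) (integrable_const _)]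
      simp)
    (fun n => by
      refine le_trans (Finset.sum_le_sum fun j _ => ?_) (sum_inv_sq_mul_integral_sq_le hDi hD0 n)
      have hm2 : Measurable (Function.uncurry fun u y => (ψ j u y) ^ 2) := (hψm j).pow_const 2
      have hb2 : ∀ u y, |(ψ j u y) ^ 2| ≤ ((j : ℝ)⁻¹ * (j + j)) ^ 2 := by
        intro u y
        rw [abs_pow]
        refine pow_le_pow_left₀ (abs_nonneg _) ?_ 2
        simp only [hψ]
        rw [abs_mul, abs_of_nonneg (by positivity : (0 : ℝ) ≤ (j : ℝ)⁻¹)]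
        refine mul_le_mul_of_nonneg_left ?_ (by positivity)
        exact (abs_sub _ _).trans (add_le_add (hτj j u y) (hτint j u))
      rw [integral_comp_of_indep (ℱ.le j) (hU j) (hV' (j + 1)) (hind j) hm2
        (Integrable.of_bound (hm2.comp ((hU' j).prodMk (hV' (j + 1)))).aestronglyMeasurable _
          (Eventually.of_forall fun ω => hb2 _ _)), hlaw]
      have hsqi : Integrable (fun y => (if D y ≤ (j : ℝ) then D y else 0) ^ 2) μ := by
        refine Integrable.of_bound (C := (j : ℝ) ^ 2)
          (((Measurable.ite (measurableSet_le hD measurable_const) hD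
            measurable_const).pow_const 2).aestronglyMeasurable)
          (Eventually.of_forall fun y => ?_)
        rw [Real.norm_eq_abs, abs_pow]
        refine pow_le_pow_left₀ (abs_nonneg _) ?_ 2
        split_ifs with h
        · rw [abs_of_nonneg (hD0 y)]; exact h
        · simp
      -- the centered square is at most the square
      have hle : ∀ u, ∫ y, (ψ j u y) ^ 2 ∂μ ≤
          ((j : ℝ) ^ 2)⁻¹ * ∫ y, (if D y ≤ (j : ℝ) then D y else 0) ^ 2 ∂μ := by
        intro u
        set c := ∫ z, τ j u z ∂μ with hc
        have i2 : Integrable (fun y => (τ j u y) ^ 2) μ :=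
          hsqi.mono' ((hτu j u).pow_const 2).aestronglyMeasurable
            (Eventually.of_forall fun y => by
              rw [Real.norm_eq_abs, abs_pow]
              exact pow_le_pow_left₀ (abs_nonneg _) (hτD j u y) 2)
        have e1 : ∀ y, (ψ j u y) ^ 2 =
            ((j : ℝ) ^ 2)⁻¹ * ((τ j u y) ^ 2 - 2 * c * τ j u y + c ^ 2) := by
          intro y
          simp only [hψ, mul_pow, inv_pow, ← hc]
          ring
        simp_rw [e1]
        rw [integral_const_mul]
        refine mul_le_mul_of_nonneg_left ?_ (by positivity)
        have i3 : Integrable (fun y => (τ j u y) ^ 2 - 2 * c * τ j u y) μ :=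
          i2.sub ((hτi j u).const_mul _)
        rw [integral_add i3 (integrable_const _), integral_sub i2 ((hτi j u).const_mul _), integral_const_mul, ← hc]
        have h3 : ∫ y, (τ j u y) ^ 2 ∂μ ≤ ∫ y, (if D y ≤ (j : ℝ) then D y else 0) ^ 2 ∂μ :=
          integral_mono i2 hsqi fun y => by
            simp only
            rw [← sq_abs]
            exact pow_le_pow_left₀ (abs_nonneg _) (hτD j u y) 2
        simp only [integral_const, probReal_univ, smul_eq_mul, one_mul]
        nlinarith [sq_nonneg c]
      have hi : Integrable (fun ω => ∫ y, (ψ j (U j ω) y) ^ 2 ∂μ) P := by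
        have h1 : Measurable (fun u => ∫ y, (ψ j u y) ^ 2 ∂μ) :=
          (hm2.stronglyMeasurable.integral_prod_right (ν := μ)).measurable
        refine Integrable.of_bound (h1.comp (hU' j)).aestronglyMeasurable
          (((j : ℝ)⁻¹ * (j + j)) ^ 2) (Eventually.of_forall fun ω => ?_)
        have := norm_integral_le_of_norm_le_const (μ := μ) (f := fun y => (ψ j (U j ω) y) ^ 2)
          (Eventually.of_forall fun y => hb2 (U j ω) y)
        simpa using this
      calc ∫ ω, ∫ y, (ψ j (U j ω) y) ^ 2 ∂μ ∂P
          ≤ ∫ _ω, ((j : ℝ) ^ 2)⁻¹ * ∫ y, (if D y ≤ (j : ℝ) then D y else 0) ^ 2 ∂μ ∂P :=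
            integral_mono hi (integrable_const _) fun ω => hle _
        _ = _ := by simp)
  -- the tail beyond the truncation level
  have hBC : ∀ᵐ ω ∂P, ∀ᶠ j : ℕ in atTop, D (V (j + 1) ω) ≤ j := by
    have h1 : ∑' j : ℕ, P {ω | (j : ℝ) < D (V (j + 1) ω)} ≠ ∞ := by
      have h2 : ∀ j : ℕ, P {ω | (j : ℝ) < D (V (j + 1) ω)} = μ {y | (j : ℝ) < D y} := by
        intro j
        rw [← hlaw j, Measure.map_apply (hV' _) (measurableSet_lt measurable_const hD)]
        rfl
      simp_rw [h2]
      exact (tsum_measure_lt_top hDi hD0).ne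
    filter_upwards [ae_eventually_notMem h1] with ω hω
    filter_upwards [hω] with j hj
    simpa using hj
  have htail : Tendsto (fun j : ℕ => ∫ y, (if D y ≤ (j : ℝ) then 0 else D y) ∂μ) atTop (𝓝 0) := by
    have h1 := tendsto_integral_of_dominated_convergence (μ := μ) (f := fun _ => (0 : ℝ))
      (F := fun (j : ℕ) y => if D y ≤ (j : ℝ) then 0 else D y) D
      (fun j => (Measurable.ite (measurableSet_le hD measurable_const) measurable_const
        hD).aestronglyMeasurable) hDi
      (fun j => Eventually.of_forall fun y => by
        split_ifs
        · simpa using hD0 y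
        · rw [Real.norm_eq_abs, abs_of_nonneg (hD0 y)])
      (Eventually.of_forall fun y => by
        refine tendsto_const_nhds.congr' ?_
        filter_upwards [eventually_ge_atTop ⌈D y⌉₊] with j hj
        rw [if_pos ((Nat.le_ceil _).trans (by exact_mod_cast hj))])
    simpa using h1
  have hbias : ∀ j u, |(∫ y, φ u y ∂μ) - ∫ y, τ j u y ∂μ| ≤
      ∫ y, (if D y ≤ (j : ℝ) then 0 else D y) ∂μ := by
    intro j u
    rw [← integral_sub (hφi u) (hτi j u)]
    refine (norm_integral_le_integral_norm (μ := μ) (fun y => φ u y - τ j u y)).trans ?_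
    have him : Measurable fun y => if D y ≤ (j : ℝ) then 0 else D y :=
      Measurable.ite (measurableSet_le hD measurable_const) measurable_const hD
    refine integral_mono (((hφi u).sub (hτi j u)).norm) (hDi.mono' him.aestronglyMeasurable
      (Eventually.of_forall fun y => ?_)) fun y => ?_
    · split_ifs
      · simpa using hD0 y
      · rw [Real.norm_eq_abs, abs_of_nonneg (hD0 y)]
    · simp only [hτ]
      split_ifs
      · simp
      · simpa using hφD u y
  filter_upwards [hconv, hBC] with ω hω hB
  obtain ⟨s, hs⟩ := hω
  have h1 := tendsto_sum_mul_div_of_tendsto_sum hs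
  -- the remainder between the original and the truncated centered terms
  have h2 : Tendsto (fun j : ℕ => (φ (U j ω) (V (j + 1) ω) - ∫ y, φ (U j ω) y ∂μ) -
      (j : ℝ) * ψ j (U j ω) (V (j + 1) ω)) atTop (𝓝 0) := by
    refine squeeze_zero_norm' ?_ htail
    filter_upwards [hB, eventually_gt_atTop 0] with j hj hj0
    have : (j : ℝ) ≠ 0 := by positivity
    simp only [hψ]
    rw [mul_inv_cancel_left₀ this]
    have e : τ j (U j ω) (V (j + 1) ω) = φ (U j ω) (V (j + 1) ω) := by simp [hτ, hj]
    rw [e, Real.norm_eq_abs]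
    refine le_trans (le_of_eq ?_) (hbias j (U j ω))
    rw [← abs_neg]
    congr 1
    ring
  have h3 := h1.add h2.cesaro
  rw [add_zero] at h3
  refine h3.congr fun n => ?_
  rw [Finset.sum_sub_distrib (f := fun j => φ (U j ω) (V (j + 1) ω) - ∫ y, φ (U j ω) y ∂μ)]
  ring

end LLN

/-! ### One slot under a general stopping rule -/

section Slot

variable {K : ℕ}

/-- The number of probes in a slot with probing order `π`, normalized rates `s` and stopping
rule `S`: the first `j ≥ 1` such that `S j` accepts the best rate among the first `j`. -/
def firstStop (S : ℕ → ℝ≥0∞ → Prop) (π : Equiv.Perm (Fin K)) (s : Fin K → ℝ≥0∞) : ℕ :=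
  sInf {j : ℕ | 1 ≤ j ∧ S j (best π s j)}

/-- User `k` is selected under the stopping rule `S`: it is the first best one among the probed
users. -/
def IsSelected (S : ℕ → ℝ≥0∞ → Prop) (π : Equiv.Perm (Fin K)) (s : Fin K → ℝ≥0∞) (k : Fin K) :
    Prop :=
  ((π.symm k : Fin K) : ℕ) < firstStop S π s ∧ s k = best π s (firstStop S π s) ∧
    ∀ i : Fin K, i < π.symm k → s (π i) < s k

theorem numProbed_eq_firstStop (β : ℝ) (ν : Measure ℝ) (r : Fin K → ℝ)
    (ord : (Fin K → ℝ≥0∞) → Equiv.Perm (Fin K)) (t ρ : Fin K → ℝ) :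
    numProbed β ν r ord t ρ = firstStop (Stops β ν r t (ord (normRate t r)))
      (ord (normRate t r)) (normRate t ρ) := rfl

theorem scheduled_iff_isSelected (β : ℝ) (ν : Measure ℝ) (r : Fin K → ℝ)
    (ord : (Fin K → ℝ≥0∞) → Equiv.Perm (Fin K)) (t ρ : Fin K → ℝ) (k : Fin K) :
    Scheduled β ν r ord t ρ k ↔ IsSelected (Stops β ν r t (ord (normRate t r)))
      (ord (normRate t r)) (normRate t ρ) k := Iff.rfl

theorem le_best {π : Equiv.Perm (Fin K)} {s : Fin K → ℝ≥0∞} {j : ℕ} {i : Fin K}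
    (h : (i : ℕ) < j) : s (π i) ≤ best π s j :=
  Finset.le_sup (f := fun i => s (π i)) (by simpa using h)

theorem best_le {π : Equiv.Perm (Fin K)} {s : Fin K → ℝ≥0∞} {j : ℕ} {c : ℝ≥0∞}
    (h : ∀ i : Fin K, (i : ℕ) < j → s (π i) ≤ c) : best π s j ≤ c :=
  Finset.sup_le fun i hi => h i (by simpa using hi)

theorem best_congr {π : Equiv.Perm (Fin K)} {s s' : Fin K → ℝ≥0∞} {j : ℕ}
    (h : ∀ i : Fin K, (i : ℕ) < j → s (π i) = s' (π i)) : best π s j = best π s' j :=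
  Finset.sup_congr rfl fun i hi => h i (by simpa using hi)

variable {S : ℕ → ℝ≥0∞ → Prop} {π : Equiv.Perm (Fin K)} {s s' : Fin K → ℝ≥0∞}

theorem firstStop_spec (hK : 0 < K) (hSK : ∀ w, S K w) :
    1 ≤ firstStop S π s ∧ S (firstStop S π s) (best π s (firstStop S π s)) :=
  Nat.sInf_mem (s := {j : ℕ | 1 ≤ j ∧ S j (best π s j)}) ⟨K, hK, hSK _⟩

theorem firstStop_le {j : ℕ} (hj : 1 ≤ j) (h : S j (best π s j)) : firstStop S π s ≤ j :=
  Nat.sInf_le ⟨hj, h⟩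

theorem not_of_lt_firstStop {j : ℕ} (hj : 1 ≤ j) (h : j < firstStop S π s) :
    ¬ S j (best π s j) := fun hS => absurd (firstStop_le hj hS) (not_le.mpr h)

theorem firstStop_le_card (hK : 0 < K) (hSK : ∀ w, S K w) : firstStop S π s ≤ K :=
  firstStop_le hK (hSK _)

theorem firstStop_eq_iff (hK : 0 < K) (hSK : ∀ w, S K w) {j : ℕ} :
    firstStop S π s = j ↔
      (1 ≤ j ∧ S j (best π s j)) ∧ ∀ i, 1 ≤ i → i < j → ¬ S i (best π s i) := by
  constructor
  · rintro rfl
    exact ⟨firstStop_spec hK hSK, fun i hi hij => not_of_lt_firstStop hi hij⟩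
  · rintro ⟨⟨h1, h2⟩, h3⟩
    refine le_antisymm (firstStop_le h1 h2) (not_lt.mp fun hlt => ?_)
    have := firstStop_spec (π := π) (s := s) hK hSK
    exact h3 _ this.1 hlt this.2

theorem IsSelected.unique {k l : Fin K} (hk : IsSelected S π s k) (hl : IsSelected S π s l) :
    k = l := by
  rcases lt_trichotomy (π.symm k) (π.symm l) with h | h | h
  · have h1 := hl.2.2 _ h
    rw [Equiv.apply_symm_apply, hk.2.1, hl.2.1] at h1
    exact absurd h1 (lt_irrefl _)
  · exact π.symm.injective h
  · have h1 := hk.2.2 _ h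
    rw [Equiv.apply_symm_apply, hk.2.1, hl.2.1] at h1
    exact absurd h1 (lt_irrefl _)

theorem exists_isSelected (hK : 0 < K) (hSK : ∀ w, S K w) : ∃ k, IsSelected S π s k := by
  set J := firstStop S π s with hJ
  have hJ1 : 1 ≤ J := (firstStop_spec hK hSK).1
  obtain ⟨i, hi, hbest⟩ := Finset.exists_mem_eq_sup (Finset.univ.filter fun i : Fin K => (i : ℕ) < J)
    ⟨⟨0, hK⟩, by simpa using Nat.lt_of_succ_le hJ1⟩ (fun i => s (π i))
  have hne : (Finset.univ.filter fun i : Fin K => (i : ℕ) < J ∧ s (π i) = best π s J).Nonempty :=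
    ⟨i, by simpa using ⟨by simpa using hi, hbest.symm⟩⟩
  set m := Finset.min' _ hne with hm
  have hmem := Finset.min'_mem _ hne
  rw [← hm] at hmem
  simp only [Finset.mem_filter, Finset.mem_univ, true_and] at hmem
  refine ⟨π m, by simpa using hmem.1, hmem.2, fun i hi => ?_⟩
  rw [Equiv.symm_apply_apply] at hi
  have hiJ : (i : ℕ) < J := lt_trans hi hmem.1
  rw [hmem.2]
  refine lt_of_le_of_ne (le_best hiJ) fun heq => ?_
  exact absurd (Finset.min'_le _ i (by simpa using ⟨hiJ, heq⟩)) (not_le.mpr hi)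

/-- The exchange property. Let user `k` precede user `l` in the probing order, and pass from `s`
to rates `s'` in which `k` is at least as good as `l` was, `l` is at most as good as `k` was, and
the other users are unchanged. If `l` is selected for `s`, then `k` is selected for `s'`, and no
more probes are needed. -/
theorem IsSelected.exchange (hK : 0 < K) (hSK : ∀ w, S K w)
    (hmono : ∀ j w w', w ≤ w' → S j w → S j w') {k l : Fin K} (hkl : π.symm k < π.symm l)
    (hs : ∀ i, i ≠ k → i ≠ l → s' i = s i) (hk : s l ≤ s' k) (hl : s' l ≤ s k)
    (h : IsSelected S π s l) : IsSelected S π s' k ∧ firstStop S π s' ≤ firstStop S π s := by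
  set J := firstStop S π s with hJ
  obtain ⟨h1, h2, h3⟩ := h
  rw [← hJ] at h1 h2
  have hearly : ∀ i, i < π.symm k → s' (π i) = s (π i) := fun i hi =>
    hs _ (fun e => by rw [← e, Equiv.symm_apply_apply] at hi; exact lt_irrefl _ hi)
      (fun e => by
        rw [← e, Equiv.symm_apply_apply] at hkl; exact lt_asymm hi hkl)
  have hsk : s k < s l := by simpa using h3 _ hkl
  have hkJ : ((π.symm k : Fin K) : ℕ) < J := lt_trans hkl h1
  have hle : firstStop S π s' ≤ J := by
    have hspec := firstStop_spec (S := S) (π := π) (s := s) hK hSK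
    refine firstStop_le hspec.1 (hmono _ _ _ ?_ hspec.2)
    rw [← hJ, ← h2]
    refine hk.trans ?_
    simpa using le_best (π := π) (s := s') (i := π.symm k) hkJ
  have hgt : ((π.symm k : Fin K) : ℕ) < firstStop S π s' := by
    by_contra hcon
    push Not at hcon
    have hspec := firstStop_spec (S := S) (π := π) (s := s') hK hSK
    refine not_of_lt_firstStop (S := S) (π := π) (s := s) hspec.1
      (lt_of_le_of_lt hcon hkJ) ?_
    rw [best_congr (s' := s') (j := firstStop S π s') fun i hi =>
      (hearly i (Fin.lt_def.mpr (lt_of_lt_of_le hi hcon))).symm]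
    exact hspec.2
  refine ⟨⟨hgt, le_antisymm ?_ ?_, ?_⟩, hle⟩
  · simpa using le_best (π := π) (s := s') (i := π.symm k) hgt
  · refine best_le fun i hi => ?_
    by_cases e1 : π i = k
    · rw [e1]
    by_cases e2 : π i = l
    · rw [e2]
      exact hl.trans (hsk.le.trans hk)
    · rw [hs _ e1 e2]
      refine le_trans ?_ hk
      rw [h2]
      exact le_best (lt_of_lt_of_le hi hle)
  · intro i hi
    rw [hearly i hi]
    exact (h3 i (hi.trans hkl)).trans_le hk

end Slot

/-! ### The stopping rule of the algorithm -/

section StopsRule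

variable {K : ℕ} {β : ℝ} {ν : Measure ℝ} {r t : Fin K → ℝ} {π : Equiv.Perm (Fin K)}

theorem stops_card (w : ℝ≥0∞) : Stops β ν r t π K w := fun h => absurd h (lt_irrefl _)

theorem stops_of_one_le {j : ℕ} (h : 1 ≤ ((j : ℝ) + 1) * β) (w : ℝ≥0∞) :
    Stops β ν r t π j w := fun _ => by
  rw [ENNReal.ofReal_of_nonpos (by linarith), zero_mul]
  exact zero_le

theorem Stops.mono [IsProbabilityMeasure ν] (hβ : 0 < β) {j : ℕ} {w w' : ℝ≥0∞} (hw : w ≤ w')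
    (h : Stops β ν r t π j w) : Stops β ν r t π j w' := by
  intro hj
  have h1 := h hj
  set c := ENNReal.ofReal (1 - ((j : ℝ) + 1) * β)
  set d := ENNReal.ofReal (1 - (j : ℝ) * β)
  set f : ℝ → ℝ≥0∞ := fun x => ENNReal.ofReal (r (π ⟨j, hj⟩) * x) / ENNReal.ofReal (t (π ⟨j, hj⟩))
  have hcd : c ≤ d := ENNReal.ofReal_le_ofReal (by linarith)
  have e : w + (w' - w) = w' := add_tsub_cancel_of_le hw
  calc c * ∫⁻ x, max w' (f x) ∂ν ≤ c * ∫⁻ x, (max w (f x) + (w' - w)) ∂ν := by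
        gcongr with x
        refine max_le ?_ ((le_max_right _ _).trans le_self_add)
        calc w' = w + (w' - w) := e.symm
          _ ≤ _ := by gcongr; exact le_max_left _ _
    _ = c * ∫⁻ x, max w (f x) ∂ν + c * (w' - w) := by
        rw [lintegral_add_right _ measurable_const, mul_add]
        simp
    _ ≤ d * w + d * (w' - w) := by gcongr
    _ = d * w' := by rw [← mul_add, e]

variable {ord : (Fin K → ℝ≥0∞) → Equiv.Perm (Fin K)} {ρ : Fin K → ℝ}

theorem one_le_firstStop (hK : 0 < K) (s : Fin K → ℝ≥0∞) :
    1 ≤ firstStop (Stops β ν r t π) π s :=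
  (firstStop_spec hK stops_card).1

/-- A second probe is only made if it leaves part of the slot for transmission. -/
theorem firstStop_eq_one_or_mul_lt_one (hK : 0 < K) (s : Fin K → ℝ≥0∞) :
    firstStop (Stops β ν r t π) π s = 1 ∨ (firstStop (Stops β ν r t π) π s : ℝ) * β < 1 := by
  set J := firstStop (Stops β ν r t π) π s with hJ
  have hJ1 : 1 ≤ J := one_le_firstStop hK s
  rcases hJ1.eq_or_lt with h | h
  · exact Or.inl h.symm
  · right
    by_contra hcon
    push Not at hcon
    refine not_of_lt_firstStop (S := Stops β ν r t π) (π := π) (s := s) (j := J - 1) (by omega)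
      (by omega) (stops_of_one_le ?_ _)
    have : (((J - 1 : ℕ) : ℝ) + 1) = J := by
      have : J - 1 + 1 = J := by omega
      exact_mod_cast this
    rwa [this]

theorem firstStop_mul_le_one (hK : 0 < K) (hβ1 : β ≤ 1) (s : Fin K → ℝ≥0∞) :
    (firstStop (Stops β ν r t π) π s : ℝ) * β ≤ 1 := by
  rcases firstStop_eq_one_or_mul_lt_one (β := β) (ν := ν) (r := r) (t := t) (π := π) hK s
    with h | h
  · rw [h]; simpa using hβ1
  · exact h.le

theorem firstStop_mul_lt_one (hK : 0 < K) (hβ1 : β < 1) (s : Fin K → ℝ≥0∞) :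
    (firstStop (Stops β ν r t π) π s : ℝ) * β < 1 := by
  rcases firstStop_eq_one_or_mul_lt_one (β := β) (ν := ν) (r := r) (t := t) (π := π) hK s
    with h | h
  · rw [h]; simpa using hβ1
  · exact h

/-- A uniform lower bound for the positive numbers `1 - j β` with `j ≤ K`. -/
theorem exists_pos_le_one_sub (K : ℕ) (β : ℝ) :
    ∃ δ : ℝ, 0 < δ ∧ ∀ j : ℕ, j ≤ K → (j : ℝ) * β < 1 → δ ≤ 1 - (j : ℝ) * β := by
  induction K with
  | zero => exact ⟨1, one_pos, fun j hj _ => by simp [Nat.le_zero.mp hj]⟩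
  | succ K ih =>
    obtain ⟨δ, h0, h2⟩ := ih
    by_cases h : ((K + 1 : ℕ) : ℝ) * β < 1
    · refine ⟨min δ (1 - ((K + 1 : ℕ) : ℝ) * β), lt_min h0 (by linarith),
        fun j hj hjβ => ?_⟩
      rcases Nat.le_succ_iff.mp hj with h3 | h3
      · exact (min_le_left _ _).trans (h2 j h3 hjβ)
      · rw [h3]; exact min_le_right _ _
    · refine ⟨δ, h0, fun j hj hjβ => ?_⟩
      rcases Nat.le_succ_iff.mp hj with h3 | h3
      · exact h2 j h3 hjβ
      · rw [h3] at hjβ; exact absurd hjβ h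

end StopsRule

/-! ### The normalized service in one slot -/

section Reward

variable {K : ℕ}

open Classical in
/-- The amount of data sent to user `k` in a slot, divided by `r k`, when the normalized rates are
`x` and the throughputs are `t`; `π` is the probing order. -/
def reward (β : ℝ) (ν : Measure ℝ) (r : Fin K → ℝ) (t : Fin K → ℝ) (π : Equiv.Perm (Fin K))
    (x : Fin K → ℝ) (k : Fin K) : ℝ :=
  if IsSelected (Stops β ν r t π) π (normRate t fun i => r i * x i) k then
    (1 - (firstStop (Stops β ν r t π) π (normRate t fun i => r i * x i) : ℝ) * β) * x k
  else 0

variable {β : ℝ} {ν : Measure ℝ} {r t : Fin K → ℝ} {π : Equiv.Perm (Fin K)} {x : Fin K → ℝ}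

theorem served_eq (ord : (Fin K → ℝ≥0∞) → Equiv.Perm (Fin K)) (k : Fin K) :
    served β ν r ord t (fun i => r i * x i) k =
      r k * reward β ν r t (ord (normRate t r)) x k := by
  by_cases h : IsSelected (Stops β ν r t (ord (normRate t r))) (ord (normRate t r))
      (normRate t fun i => r i * x i) k
  · rw [served, if_pos ((scheduled_iff_isSelected ..).mpr h), reward, if_pos h,
      numProbed_eq_firstStop]
    ring
  · rw [served, if_neg (fun h' => h ((scheduled_iff_isSelected ..).mp h')), reward, if_neg h,
      mul_zero]

theorem normRate_mul (hr : ∀ k, 0 < r k) (k : Fin K) :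
    normRate t (fun i => r i * x i) k = ENNReal.ofReal (x k) * normRate t r k := by
  simp only [normRate]
  rw [ENNReal.ofReal_mul (hr k).le, mul_comm (ENNReal.ofReal (r k)), mul_div_assoc]

theorem abs_reward_le (hK : 0 < K) (hβ0 : 0 < β) (hβ1 : β ≤ 1) (k : Fin K) :
    |reward β ν r t π x k| ≤ |x k| := by
  unfold reward
  split_ifs with h
  · have h1 := firstStop_mul_le_one (β := β) (ν := ν) (r := r) (t := t) (π := π) hK hβ1
      (normRate t fun i => r i * x i)
    have h2 : 0 ≤ (firstStop (Stops β ν r t π) π (normRate t fun i => r i * x i) : ℝ) * β := by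
      positivity
    rw [abs_mul]
    refine mul_le_of_le_one_left (abs_nonneg _) ?_
    rw [abs_le]
    constructor <;> linarith
  · simp

theorem reward_nonneg (hK : 0 < K) (hβ1 : β ≤ 1) (hx : ∀ i, 0 ≤ x i) (k : Fin K) :
    0 ≤ reward β ν r t π x k := by
  unfold reward
  split_ifs with h
  · have h1 := firstStop_mul_le_one (β := β) (ν := ν) (r := r) (t := t) (π := π) hK hβ1
      (normRate t fun i => r i * x i)
    exact mul_nonneg (by linarith) (hx k)
  · exact le_rfl

/-- Exchanging the rates of a user `k` and a user `l` behind it in the probing order turns every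
slot in which `l` is served into one in which `k` is served at least as much. -/
theorem reward_le_reward_swap [IsProbabilityMeasure ν] (hK : 0 < K) (hβ0 : 0 < β)
    (hβ1 : β ≤ 1) (hr : ∀ k, 0 < r k) (hπ : Antitone (normRate t r ∘ π)) {k l : Fin K}
    (hkl : π.symm k < π.symm l) (hx : ∀ i, 0 ≤ x i) :
    reward β ν r t π x l ≤ reward β ν r t π (x ∘ Equiv.swap k l) k := by
  have hx' : ∀ i, 0 ≤ (x ∘ Equiv.swap k l) i := fun i => hx _
  by_cases h : IsSelected (Stops β ν r t π) π (normRate t fun i => r i * x i) l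
  · have ha : normRate t r l ≤ normRate t r k := by simpa using hπ hkl.le
    obtain ⟨h1, h2⟩ := h.exchange (s' := normRate t fun i => r i * (x ∘ Equiv.swap k l) i) hK
      stops_card (fun j w w' hw => Stops.mono hβ0 hw) hkl
      (fun i hik hil => by
        rw [normRate_mul hr, normRate_mul hr, Function.comp_apply,
          Equiv.swap_apply_of_ne_of_ne hik hil])
      (by
        rw [normRate_mul hr, normRate_mul hr, Function.comp_apply, Equiv.swap_apply_left]
        gcongr)
      (by
        rw [normRate_mul hr, normRate_mul hr, Function.comp_apply, Equiv.swap_apply_right]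
        gcongr)
    rw [reward, if_pos h, reward, if_pos h1, Function.comp_apply, Equiv.swap_apply_left]
    have := hx l
    have h3 : (firstStop (Stops β ν r t π) π
        (normRate t fun i => r i * (x ∘ Equiv.swap k l) i) : ℝ) ≤
      firstStop (Stops β ν r t π) π (normRate t fun i => r i * x i) := by exact_mod_cast h2
    gcongr
  · rw [reward, if_neg h]
    exact reward_nonneg hK hβ1 hx' k

theorem sum_reward_eq {k : Fin K}
    (h : IsSelected (Stops β ν r t π) π (normRate t fun i => r i * x i) k) :
    ∑ i, reward β ν r t π x i =
      (1 - (firstStop (Stops β ν r t π) π (normRate t fun i => r i * x i) : ℝ) * β) * x k := by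
  rw [Finset.sum_eq_single k, reward, if_pos h]
  · intro i _ hik
    rw [reward, if_neg fun h' => hik (h'.unique h)]
  · simp

/-- The selected user has at least the rate of the user probed first, because the latter has the
largest mean normalized rate. -/
theorem le_of_isSelected (hK : 0 < K) (hr : ∀ k, 0 < r k) (hπ : Antitone (normRate t r ∘ π))
    {S : ℕ → ℝ≥0∞ → Prop} {k : Fin K}
    (h : IsSelected S π (normRate t fun i => r i * x i) k) : x (π ⟨0, hK⟩) ≤ x k := by
  by_cases hk : π.symm k = ⟨0, hK⟩
  · rw [← hk, Equiv.apply_symm_apply]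
  · have h0 : (⟨0, hK⟩ : Fin K) < π.symm k := by
      rw [Fin.lt_def]
      exact Nat.pos_of_ne_zero fun h => hk (Fin.ext h)
    have h1 := h.2.2 _ h0
    rw [normRate_mul hr, normRate_mul hr] at h1
    have h2 : normRate t r k ≤ normRate t r (π ⟨0, hK⟩) := by simpa using hπ h0.le
    have h3 := lt_of_mul_lt_mul_right' (h1.trans_le (mul_le_mul_right h2 (ENNReal.ofReal (x k))))
    by_contra hcon
    push Not at hcon
    exact absurd (ENNReal.ofReal_le_ofReal hcon.le) (not_le.mpr h3)

theorem mul_le_sum_reward (hK : 0 < K) (hβ1 : β < 1) (hr : ∀ k, 0 < r k)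
    (hπ : Antitone (normRate t r ∘ π)) (hx : ∀ i, 0 ≤ x i) {δ : ℝ} (hδ0 : 0 < δ)
    (hδ : ∀ j : ℕ, j ≤ K → (j : ℝ) * β < 1 → δ ≤ 1 - (j : ℝ) * β) :
    δ * x (π ⟨0, hK⟩) ≤ ∑ i, reward β ν r t π x i := by
  obtain ⟨k, hk⟩ := exists_isSelected (S := Stops β ν r t π) (π := π)
    (s := normRate t fun i => r i * x i) hK stops_card
  rw [sum_reward_eq hk]
  have h1 := hδ _ (firstStop_le_card (π := π) (s := normRate t fun i => r i * x i) hK stops_card)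
    (firstStop_mul_lt_one (β := β) (ν := ν) (r := r) (t := t) (π := π) hK hβ1 _)
  exact mul_le_mul h1 (le_of_isSelected hK hr hπ hk) (hx _) (hδ0.le.trans h1)

end Reward

/-! ### Measurability of the slot -/

section Measurability

variable {K : ℕ} {β : ℝ} {ν : Measure ℝ} {r : Fin K → ℝ}

/-- A function that is chosen measurably from a finite family of measurable functions is
measurable. -/
theorem measurable_of_finite_choice {α γ ι : Type*} [MeasurableSpace α] [MeasurableSpace γ]
    [Finite ι] {o : α → ι} (ho : ∀ i, MeasurableSet {z | o z = i}) {F : ι → α → γ}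
    (hF : ∀ i, Measurable (F i)) : Measurable fun z => F (o z) z := by
  intro s hs
  have : (fun z => F (o z) z) ⁻¹' s = ⋃ i, {z | o z = i} ∩ F i ⁻¹' s := by
    ext z
    simp
  rw [this]
  exact MeasurableSet.iUnion fun i => (ho i).inter (hF i hs)

theorem measurable_normRate : Measurable fun z : (Fin K → ℝ) × (Fin K → ℝ) =>
    normRate z.1 z.2 := by
  unfold normRate
  refine measurable_pi_lambda _ fun k => ?_
  fun_prop

theorem measurable_best (π : Equiv.Perm (Fin K)) (j : ℕ) :
    Measurable fun s : Fin K → ℝ≥0∞ => best π s j := by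
  simp only [best, Finset.sup_eq_iSup]
  exact Measurable.iSup fun i => Measurable.iSup fun _ => measurable_pi_apply _

theorem measurableSet_stops [SFinite ν] (π : Equiv.Perm (Fin K)) (j : ℕ) :
    MeasurableSet {z : (Fin K → ℝ) × ℝ≥0∞ | Stops β ν r z.1 π j z.2} := by
  by_cases h : j < K
  · have : {z : (Fin K → ℝ) × ℝ≥0∞ | Stops β ν r z.1 π j z.2} =
        {z | ENNReal.ofReal (1 - ((j : ℝ) + 1) * β) * ∫⁻ x, max z.2
          (ENNReal.ofReal (r (π ⟨j, h⟩) * x) / ENNReal.ofReal (z.1 (π ⟨j, h⟩))) ∂ν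
          ≤ ENNReal.ofReal (1 - (j : ℝ) * β) * z.2} := by
      ext z
      exact ⟨fun hz => hz h, fun hz _ => hz⟩
    rw [this]
    refine measurableSet_le ?_ (by fun_prop)
    refine Measurable.const_mul ?_ _
    exact Measurable.lintegral_prod_right' (f := fun p : ((Fin K → ℝ) × ℝ≥0∞) × ℝ =>
      max p.1.2 (ENNReal.ofReal (r (π ⟨j, h⟩) * p.2) / ENNReal.ofReal (p.1.1 (π ⟨j, h⟩))))
      (by fun_prop)
  · convert MeasurableSet.univ
    ext z
    simp only [Set.mem_ofPred_eq, Set.mem_univ, iff_true]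
    exact fun h' => absurd h' h

theorem measurable_firstStop [SFinite ν] (hK : 0 < K) (π : Equiv.Perm (Fin K)) :
    Measurable fun z : (Fin K → ℝ) × (Fin K → ℝ) =>
      firstStop (Stops β ν r z.1 π) π (normRate z.1 z.2) := by
  refine measurable_to_countable' fun j => ?_
  have hset : ∀ i, MeasurableSet {z : (Fin K → ℝ) × (Fin K → ℝ) |
      Stops β ν r z.1 π i (best π (normRate z.1 z.2) i)} := fun i =>
    (measurable_fst.prodMk ((measurable_best π i).comp measurable_normRate))
      (measurableSet_stops (β := β) (ν := ν) (r := r) π i)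
  have : (fun z : (Fin K → ℝ) × (Fin K → ℝ) =>
      firstStop (Stops β ν r z.1 π) π (normRate z.1 z.2)) ⁻¹' {j} =
      ({z | 1 ≤ j} ∩ {z | Stops β ν r z.1 π j (best π (normRate z.1 z.2) j)}) ∩
        ⋂ i, ⋂ (_ : 1 ≤ i), ⋂ (_ : i < j),
          {z | Stops β ν r z.1 π i (best π (normRate z.1 z.2) i)}ᶜ := by
    ext z
    simp only [Set.mem_preimage, Set.mem_singleton_iff, firstStop_eq_iff hK stops_card]
    simp
  rw [this]
  exact ((MeasurableSet.const _).inter (hset j)).inter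
    (MeasurableSet.iInter fun i => MeasurableSet.iInter fun _ => MeasurableSet.iInter fun _ =>
      (hset i).compl)

theorem measurableSet_isSelected [SFinite ν] (hK : 0 < K) (π : Equiv.Perm (Fin K)) (k : Fin K) :
    MeasurableSet {z : (Fin K → ℝ) × (Fin K → ℝ) |
      IsSelected (Stops β ν r z.1 π) π (normRate z.1 z.2) k} := by
  have hJ := measurable_firstStop (β := β) (ν := ν) (r := r) hK π
  have hs : ∀ i : Fin K, Measurable fun z : (Fin K → ℝ) × (Fin K → ℝ) => normRate z.1 z.2 i :=
    fun i => (measurable_pi_apply i).comp measurable_normRate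
  have hb : Measurable fun z : (Fin K → ℝ) × (Fin K → ℝ) =>
      best π (normRate z.1 z.2) (firstStop (Stops β ν r z.1 π) π (normRate z.1 z.2)) :=
    (measurable_from_prod_countable_left (f := fun p : ((Fin K → ℝ) × (Fin K → ℝ)) × ℕ =>
      best π (normRate p.1.1 p.1.2) p.2)
      fun j => (measurable_best π j).comp measurable_normRate).comp (measurable_id.prodMk hJ)
  refine (measurableSet_lt measurable_const hJ).inter
    ((measurableSet_eq_fun (hs k) hb).inter ?_)
  have : {z : (Fin K → ℝ) × (Fin K → ℝ) | ∀ i : Fin K, i < π.symm k →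
      normRate z.1 z.2 (π i) < normRate z.1 z.2 k} =
      ⋂ i, ⋂ (_ : i < π.symm k), {z | normRate z.1 z.2 (π i) < normRate z.1 z.2 k} := by
    ext z
    simp
  have hm : MeasurableSet {z : (Fin K → ℝ) × (Fin K → ℝ) | ∀ i : Fin K, i < π.symm k →
      normRate z.1 z.2 (π i) < normRate z.1 z.2 k} := by
    rw [this]
    exact MeasurableSet.iInter fun i => MeasurableSet.iInter fun _ =>
      measurableSet_lt (hs _) (hs k)
  exact hm

theorem measurable_mul_rates : Measurable fun z : (Fin K → ℝ) × (Fin K → ℝ) =>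
    (z.1, fun i => r i * z.2 i) := by fun_prop

theorem measurable_reward [SFinite ν] (hK : 0 < K) (π : Equiv.Perm (Fin K)) (k : Fin K) :
    Measurable fun z : (Fin K → ℝ) × (Fin K → ℝ) => reward β ν r z.1 π z.2 k := by
  classical
  unfold reward
  have hJ := (measurable_firstStop (β := β) (ν := ν) (r := r) hK π).comp
    (measurable_mul_rates (r := r))
  refine Measurable.ite ((measurable_mul_rates (r := r))
    (measurableSet_isSelected (β := β) (ν := ν) (r := r) hK π k)) ?_ measurable_const
  have hJ' : Measurable fun z : (Fin K → ℝ) × (Fin K → ℝ) =>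
      (firstStop (Stops β ν r z.1 π) π (normRate z.1 fun i => r i * z.2 i) : ℝ) :=
    (measurable_from_nat (f := fun n : ℕ => (n : ℝ))).comp hJ
  exact ((hJ'.mul_const _).const_sub 1).mul ((measurable_pi_apply k).comp measurable_snd)

variable {ord : (Fin K → ℝ≥0∞) → Equiv.Perm (Fin K)}

theorem SortingRule.measurableSet_eq (hord : SortingRule ord) (σ : Equiv.Perm (Fin K)) :
    MeasurableSet {z : (Fin K → ℝ) × (Fin K → ℝ) | ord (normRate z.1 r) = σ} :=
  (measurable_normRate.comp (measurable_fst.prodMk measurable_const)) (hord.measurable σ)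

theorem measurable_reward_ord [SFinite ν] (hK : 0 < K) (hord : SortingRule ord) (k : Fin K) :
    Measurable fun z : (Fin K → ℝ) × (Fin K → ℝ) =>
      reward β ν r z.1 (ord (normRate z.1 r)) z.2 k :=
  measurable_of_finite_choice
    (o := fun z : (Fin K → ℝ) × (Fin K → ℝ) => ord (normRate z.1 r)) (F := fun π (z : (Fin K → ℝ) × (Fin K → ℝ)) =>
    reward β ν r z.1 π z.2 k) hord.measurableSet_eq fun π => measurable_reward hK π k

theorem measurable_firstStop_ord [SFinite ν] (hK : 0 < K) (hord : SortingRule ord) :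
    Measurable fun z : (Fin K → ℝ) × (Fin K → ℝ) =>
      firstStop (Stops β ν r z.1 (ord (normRate z.1 r))) (ord (normRate z.1 r))
        (normRate z.1 fun i => r i * z.2 i) := by
  have h : ∀ π : Equiv.Perm (Fin K), Measurable fun z : (Fin K → ℝ) × (Fin K → ℝ) =>
      firstStop (Stops β ν r z.1 π) π (normRate z.1 fun i => r i * z.2 i) := fun π => by
    have h := (measurable_firstStop (β := β) (ν := ν) (r := r) hK π).comp
      (measurable_mul_rates (r := r))
    exact h
  exact measurable_of_finite_choice
    (o := fun z : (Fin K → ℝ) × (Fin K → ℝ) => ord (normRate z.1 r)) hord.measurableSet_eq h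

end Measurability

/-! ### Mean service and the drift towards equal normalized throughputs -/

section Drift

variable {K : ℕ} {β : ℝ} {ν : Measure ℝ} [IsProbabilityMeasure ν] {r t : Fin K → ℝ}

/-- Selecting coordinates of an i.i.d. family yields an i.i.d. family. -/
theorem measurePreserving_comp_injective {ι ι' : Type*} [Fintype ι] [Fintype ι'] {f : ι' → ι}
    (hf : Function.Injective f) :
    MeasurePreserving (fun x : ι → ℝ => x ∘ f) (Measure.pi fun _ => ν) (Measure.pi fun _ => ν) := by
  refine ⟨measurable_pi_lambda _ fun i => measurable_pi_apply _, ?_⟩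
  have h1 : iIndepFun (fun i (x : ι → ℝ) => x i) (Measure.pi fun _ : ι => ν) :=
    iIndepFun_pi (X := fun _ => id) fun _ => aemeasurable_id
  have h2 := h1.precomp hf
  have h3 := (iIndepFun_iff_map_fun_eq_pi_map
    (fun i => (measurable_pi_apply (f i)).aemeasurable)).mp h2
  refine h3.trans ?_
  congr 1
  ext1 i
  exact (measurePreserving_eval (fun _ : ι => ν) (f i)).map_eq

theorem ae_pi_nonneg (h0 : ∀ᵐ x ∂ν, 0 ≤ x) :
    ∀ᵐ x ∂(Measure.pi fun _ : Fin K => ν), ∀ i, 0 ≤ x i := by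
  rw [ae_all_iff]
  exact fun i => (measurePreserving_eval (fun _ : Fin K => ν) i).quasiMeasurePreserving.ae h0

theorem integrable_abs_apply (hi : Integrable (fun x : ℝ => x) ν) (k : Fin K) :
    Integrable (fun x : Fin K → ℝ => |x k|) (Measure.pi fun _ : Fin K => ν) :=
  ((measurePreserving_eval (fun _ : Fin K => ν) k).integrable_comp_of_integrable hi).abs

theorem integrable_reward (hK : 0 < K) (hβ0 : 0 < β) (hβ1 : β ≤ 1)
    (hi : Integrable (fun x : ℝ => x) ν) (π : Equiv.Perm (Fin K)) (k : Fin K) :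
    Integrable (fun x => reward β ν r t π x k) (Measure.pi fun _ : Fin K => ν) :=
  (integrable_abs_apply hi k).mono'
    ((measurable_reward hK π k).comp measurable_prodMk_left).aestronglyMeasurable
    (Eventually.of_forall fun _ => abs_reward_le hK hβ0 hβ1 k)

theorem integral_abs_apply (h0 : ∀ᵐ x ∂ν, 0 ≤ x) (h1 : ∫ x, x ∂ν = 1) (k : Fin K) :
    ∫ x, |x k| ∂(Measure.pi fun _ : Fin K => ν) = 1 := by
  have := (measurePreserving_eval (fun _ : Fin K => ν) k).map_eq
  have h2 : ∫ x, |x| ∂ν = ∫ x, |x k| ∂(Measure.pi fun _ : Fin K => ν) := by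
    conv_lhs => rw [← this]
    exact integral_map (measurable_pi_apply k).aemeasurable
      continuous_abs.measurable.aestronglyMeasurable
  rw [← h2, ← h1]
  refine integral_congr_ae ?_
  filter_upwards [h0] with x hx
  exact abs_of_nonneg hx

theorem abs_integral_reward_le (hK : 0 < K) (hβ0 : 0 < β) (hβ1 : β ≤ 1)
    (h0 : ∀ᵐ x ∂ν, 0 ≤ x) (hi : Integrable (fun x : ℝ => x) ν) (h1 : ∫ x, x ∂ν = 1)
    (π : Equiv.Perm (Fin K)) (k : Fin K) :
    |∫ x, reward β ν r t π x k ∂(Measure.pi fun _ : Fin K => ν)| ≤ 1 := by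
  rw [← integral_abs_apply h0 h1 k]
  refine (norm_integral_le_integral_norm (fun x => reward β ν r t π x k)).trans ?_
  exact integral_mono (integrable_reward hK hβ0 hβ1 hi π k).norm (integrable_abs_apply hi k)
    fun x => abs_reward_le hK hβ0 hβ1 k

/-- A user earlier in the probing order receives at least the normalized mean service of a later
one. -/
theorem integral_reward_le (hK : 0 < K) (hβ0 : 0 < β) (hβ1 : β ≤ 1) (hr : ∀ k, 0 < r k)
    (h0 : ∀ᵐ x ∂ν, 0 ≤ x) (hi : Integrable (fun x : ℝ => x) ν) {π : Equiv.Perm (Fin K)}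
    (hπ : Antitone (normRate t r ∘ π)) {k l : Fin K} (hkl : normRate t r l < normRate t r k) :
    ∫ x, reward β ν r t π x l ∂(Measure.pi fun _ : Fin K => ν) ≤
      ∫ x, reward β ν r t π x k ∂(Measure.pi fun _ : Fin K => ν) := by
  have hlt : π.symm k < π.symm l := by
    by_contra hcon
    push Not at hcon
    have := hπ hcon
    simp only [Function.comp_apply, Equiv.apply_symm_apply] at this
    exact absurd this (not_le.mpr hkl)
  have hmp := measurePreserving_comp_injective (ν := ν) (Equiv.swap k l).injective
  have hm : Measurable fun x => reward β ν r t π x k := by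
    have h := (measurable_reward (β := β) (ν := ν) (r := r) hK π k).comp
      (measurable_prodMk_left (x := t))
    exact h
  have e : ∫ x, reward β ν r t π (x ∘ Equiv.swap k l) k ∂(Measure.pi fun _ : Fin K => ν) =
      ∫ x, reward β ν r t π x k ∂(Measure.pi fun _ : Fin K => ν) := by
    conv_rhs => rw [← hmp.map_eq]
    exact (integral_map (f := fun x => reward β ν r t π x k) hmp.measurable.aemeasurable
      hm.aestronglyMeasurable).symm
  rw [← e]
  refine integral_mono_ae (integrable_reward hK hβ0 hβ1 hi π l)
    (hmp.integrable_comp_of_integrable (integrable_reward hK hβ0 hβ1 hi π k)) ?_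
  filter_upwards [ae_pi_nonneg h0] with x hx
  exact reward_le_reward_swap hK hβ0 hβ1 hr hπ hlt hx

/-- The total normalized mean service is bounded below, uniformly in the throughputs. -/
theorem le_sum_integral_reward (hK : 0 < K) (hβ0 : 0 < β) (hβ1 : β < 1) (hr : ∀ k, 0 < r k)
    (h0 : ∀ᵐ x ∂ν, 0 ≤ x) (hi : Integrable (fun x : ℝ => x) ν) (h1 : ∫ x, x ∂ν = 1)
    {π : Equiv.Perm (Fin K)} (hπ : Antitone (normRate t r ∘ π)) {δ : ℝ} (hδ0 : 0 < δ)
    (hδ : ∀ j : ℕ, j ≤ K → (j : ℝ) * β < 1 → δ ≤ 1 - (j : ℝ) * β) :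
    δ ≤ ∑ k, ∫ x, reward β ν r t π x k ∂(Measure.pi fun _ : Fin K => ν) := by
  rw [← integral_finsetSum _ fun k _ => integrable_reward hK hβ0 hβ1.le hi π k]
  calc δ = ∫ x, δ * |x (π ⟨0, hK⟩)| ∂(Measure.pi fun _ : Fin K => ν) := by
        rw [integral_const_mul, integral_abs_apply h0 h1, mul_one]
    _ ≤ _ := by
        refine integral_mono_ae ((integrable_abs_apply hi _).const_mul δ)
          (integrable_finsetSum _ fun k _ => integrable_reward hK hβ0 hβ1.le hi π k) ?_
        filter_upwards [ae_pi_nonneg h0] with x hx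
        rw [abs_of_nonneg (hx _)]
        exact mul_le_sum_reward hK hβ1 hr hπ hx hδ0 hδ

end Drift

/-! ### The thresholds -/

section Thresholds

variable {ν : Measure ℝ}

/-- The mean excess `E (X - v)⁺` of the law `ν` over the level `v`. -/
def meanExcess (ν : Measure ℝ) (v : ℝ) : ℝ := ∫ x, max (x - v) 0 ∂ν

theorem setIntegral_Ioi_eq_meanExcess (v : ℝ) :
    ∫ x in Set.Ioi v, (x - v) ∂ν = meanExcess ν v := by
  rw [meanExcess, ← integral_indicator measurableSet_Ioi]
  congr 1
  ext x
  by_cases h : v < x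
  · rw [Set.indicator_of_mem (Set.mem_Ioi.mpr h), max_eq_left (by linarith)]
  · rw [Set.indicator_of_notMem (by simpa using h), max_eq_right (by linarith)]

theorem meanExcess_nonneg (v : ℝ) : 0 ≤ meanExcess ν v :=
  integral_nonneg fun _ => le_max_right _ _

variable {K : ℕ} {β : ℝ} {v : ℕ → ℝ}

theorem Jmax_le : Jmax K β ≤ K := min_le_left _ _

theorem lt_card_of_lt_Jmax {j : ℕ} (h : j < Jmax K β) : j < K := h.trans_le (min_le_left _ _)

theorem mul_le_one_of_le_Jmax (hβ0 : 0 < β) {j : ℕ} (h : j ≤ Jmax K β) : (j : ℝ) * β ≤ 1 := by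
  have h1 : (j : ℝ) ≤ 1 / β := by
    refine le_trans ?_ (Nat.floor_le (by positivity : 0 ≤ 1 / β))
    exact_mod_cast h.trans (min_le_right _ _)
  rwa [le_div_iff₀ hβ0] at h1

theorem one_le_Jmax (hK : 0 < K) (hβ0 : 0 < β) (hβ1 : β ≤ 1) : 1 ≤ Jmax K β :=
  le_min hK (Nat.le_floor (by rw [Nat.cast_one, le_div_iff₀ hβ0]; linarith))

theorem coeff_nonneg (hβ0 : 0 < β) {j : ℕ} (h : j < Jmax K β) :
    0 ≤ 1 / β - ((j : ℝ) + 1) := by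
  have := mul_le_one_of_le_Jmax hβ0 (Nat.succ_le_of_lt h)
  rw [sub_nonneg, le_div_iff₀ hβ0]
  simpa using this

theorem IsThreshold.nonneg (hv : IsThreshold K β ν v) (hβ0 : 0 < β) {j : ℕ}
    (hj : j ≤ Jmax K β) : 0 ≤ v j := by
  rcases hj.lt_or_eq with h | h
  · rw [hv.1 j h, g, setIntegral_Ioi_eq_meanExcess]
    exact mul_nonneg (coeff_nonneg hβ0 h) (meanExcess_nonneg _)
  · rw [h, hv.2]

variable [IsProbabilityMeasure ν]

theorem integrable_excess (hi : Integrable (fun x : ℝ => x) ν) (v : ℝ) :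
    Integrable (fun x => max (x - v) 0) ν :=
  (hi.sub (integrable_const v)).pos_part

theorem meanExcess_antitone (hi : Integrable (fun x : ℝ => x) ν) : Antitone (meanExcess ν) :=
  fun _ _ huv => integral_mono (integrable_excess hi _) (integrable_excess hi _) fun _ =>
    max_le_max (by linarith) le_rfl

theorem meanExcess_le_add (hi : Integrable (fun x : ℝ => x) ν) {u v : ℝ} (huv : u ≤ v) :
    meanExcess ν u ≤ meanExcess ν v + (v - u) := by
  have h : ∫ x, (max (x - v) 0 + (v - u)) ∂ν = meanExcess ν v + (v - u) := by
    rw [integral_add (integrable_excess hi v) (integrable_const _)]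
    simp [meanExcess]
  rw [← h]
  refine integral_mono (integrable_excess hi u)
    ((integrable_excess hi v).add (integrable_const _)) fun x => max_le ?_ ?_
  · linarith [le_max_left (x - v) 0]
  · linarith [le_max_right (x - v) 0]

theorem continuous_meanExcess (hi : Integrable (fun x : ℝ => x) ν) :
    Continuous (meanExcess ν) := by
  have : LipschitzWith 1 (meanExcess ν) := by
    refine LipschitzWith.of_dist_le_mul fun u v => ?_
    rw [Real.dist_eq, Real.dist_eq, NNReal.coe_one, one_mul]
    rcases le_total u v with h | h
    · have h1 := meanExcess_antitone hi h
      have h2 := meanExcess_le_add hi h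
      rw [abs_of_nonneg (by linarith), abs_of_nonpos (by linarith)]
      linarith
    · have h1 := meanExcess_antitone hi h
      have h2 := meanExcess_le_add hi h
      rw [abs_of_nonpos (by linarith), abs_of_nonneg (by linarith)]
      linarith
  exact this.continuous

theorem strictMono_sub_mul_meanExcess (hi : Integrable (fun x : ℝ => x) ν) {c : ℝ} (hc : 0 ≤ c) :
    StrictMono fun v => v - c * meanExcess ν v := fun u v huv => by
  have := mul_le_mul_of_nonneg_left (meanExcess_antitone hi huv.le) hc
  simp only
  linarith

theorem existsUnique_eq_mul_meanExcess (hi : Integrable (fun x : ℝ => x) ν) {c : ℝ}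
    (hc : 0 ≤ c) : ∃! v : ℝ, v = c * meanExcess ν v := by
  have hm := strictMono_sub_mul_meanExcess hi hc
  have hcont : Continuous fun v => v - c * meanExcess ν v :=
    continuous_id.sub ((continuous_meanExcess hi).const_mul c)
  have h0 := meanExcess_nonneg (ν := ν) 0
  have hb : 0 ≤ c * meanExcess ν 0 := mul_nonneg hc h0
  have h1 := mul_le_mul_of_nonneg_left (meanExcess_antitone hi hb) hc
  obtain ⟨v, -, hv⟩ := intermediate_value_Icc hb hcont.continuousOn
    (show (0 : ℝ) ∈ Set.Icc _ _ from ⟨by simpa using hb, by simpa using h1⟩)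
  simp only at hv
  refine ⟨v, by simpa using sub_eq_zero.mp hv, fun u hu => ?_⟩
  refine hm.injective (a₁ := u) (a₂ := v) ?_
  linarith

theorem existsUnique_eq_g (hβ0 : 0 < β) (hi : Integrable (fun x : ℝ => x) ν) {j : ℕ}
    (hj : j < Jmax K β) : ∃! u : ℝ, u = g β ν j u := by
  simp only [g, setIntegral_Ioi_eq_meanExcess]
  exact existsUnique_eq_mul_meanExcess hi (coeff_nonneg hβ0 hj)

theorem IsThreshold.le_iff (hv : IsThreshold K β ν v) (hβ0 : 0 < β)
    (hi : Integrable (fun x : ℝ => x) ν) {j : ℕ} (hj : j < Jmax K β) (u : ℝ) :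
    v j ≤ u ↔ (1 / β - ((j : ℝ) + 1)) * meanExcess ν u ≤ u := by
  have h1 := hv.1 j hj
  rw [g, setIntegral_Ioi_eq_meanExcess] at h1
  have h2 := (strictMono_sub_mul_meanExcess hi (coeff_nonneg hβ0 hj)).le_iff_le
    (a := v j) (b := u)
  rw [← h2]
  constructor <;> intro h <;> linarith

theorem IsThreshold.succ_le (hv : IsThreshold K β ν v) (hβ0 : 0 < β)
    (hi : Integrable (fun x : ℝ => x) ν) {j : ℕ} (hj : j + 1 ≤ Jmax K β) : v (j + 1) ≤ v j := by
  rcases hj.lt_or_eq with h | h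
  · rw [hv.le_iff hβ0 hi h]
    have h1 := hv.1 j hj
    rw [g, setIntegral_Ioi_eq_meanExcess] at h1
    have h2 := meanExcess_nonneg (ν := ν) (v j)
    push_cast
    nlinarith
  · rw [h, hv.2]
    exact hv.nonneg hβ0 (by omega)

theorem IsThreshold.anti (hv : IsThreshold K β ν v) (hβ0 : 0 < β)
    (hi : Integrable (fun x : ℝ => x) ν) {i j : ℕ} (hij : i ≤ j) (hj : j ≤ Jmax K β) :
    v j ≤ v i := by
  induction j, hij using Nat.le_induction with
  | base => exact le_rfl
  | succ j _ ih => exact (hv.succ_le hβ0 hi hj).trans (ih (by omega))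

/-- The stopping rule is a threshold rule: after `j` probes the slot is used if the best rate,
measured in units of the mean normalized rate of the next user, is at least `v j`. -/
theorem IsThreshold.stops_iff (hv : IsThreshold K β ν v) (hβ0 : 0 < β)
    (hi : Integrable (fun x : ℝ => x) ν) {r t : Fin K → ℝ} (hr : ∀ k, 0 < r k)
    (ht : ∀ k, 0 < t k) (π : Equiv.Perm (Fin K)) {j : ℕ} {w : ℝ≥0∞} (hw : w ≠ ∞) :
    Stops β ν r t π j w ↔ ∀ h : j < Jmax K β, ENNReal.ofReal (v j) ≤
      w * ENNReal.ofReal (t (π ⟨j, lt_card_of_lt_Jmax h⟩) / r (π ⟨j, lt_card_of_lt_Jmax h⟩)) := by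
  by_cases hj : j < Jmax K β
  · simp only [hj, forall_true_left]
    have hjK := lt_card_of_lt_Jmax hj
    simp only [Stops, hjK, forall_true_left]
    obtain ⟨w, hw0, rfl⟩ : ∃ w' : ℝ, 0 ≤ w' ∧ w = ENNReal.ofReal w' :=
      ⟨w.toReal, ENNReal.toReal_nonneg, (ENNReal.ofReal_toReal hw).symm⟩
    set k := π ⟨j, hjK⟩
    have hrk := hr k
    have htk := ht k
    have hτ : 0 < t k / r k := by positivity
    rw [← ENNReal.ofReal_mul hw0, ENNReal.ofReal_le_ofReal_iff (by positivity)]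
    rw [hv.le_iff hβ0 hi hj]
    have e1 : ∀ x, max (ENNReal.ofReal w) (ENNReal.ofReal (r k * x) / ENNReal.ofReal (t k)) =
        ENNReal.ofReal (max w (r k * x / t k)) := fun x => by
      rw [← ENNReal.ofReal_div_of_pos htk, ENNReal.ofReal_max]
    have e2 : ∀ x, max w (r k * x / t k) = w + (r k / t k) * max (x - w * (t k / r k)) 0 := by
      intro x
      rw [mul_max_of_nonneg _ _ (by positivity), ← max_add_add_left, max_comm]
      congr 1
      · field_simp
        ring
      · simp
    have i2 : Integrable (fun x => w + (r k / t k) * max (x - w * (t k / r k)) 0) ν :=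
      (integrable_const _).add ((integrable_excess hi _).const_mul _)
    have hj1 := mul_le_one_of_le_Jmax hβ0 (Nat.succ_le_of_lt hj)
    push_cast at hj1
    have hc : 0 ≤ 1 - ((j : ℝ) + 1) * β := by linarith
    have hd : 0 ≤ 1 - (j : ℝ) * β := by nlinarith
    simp_rw [e1, e2]
    rw [← ofReal_integral_eq_lintegral_ofReal i2 (Eventually.of_forall fun x => by
      have := le_max_right (x - w * (t k / r k)) 0
      simp only [Pi.zero_apply]
      positivity), ← ENNReal.ofReal_mul hc, ← ENNReal.ofReal_mul hd,
      ENNReal.ofReal_le_ofReal_iff (mul_nonneg hd hw0),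
      integral_add (integrable_const _) ((integrable_excess hi _).const_mul _),
      integral_const_mul]
    simp only [integral_const, probReal_univ, smul_eq_mul, one_mul]
    change (1 - ((j : ℝ) + 1) * β) * (w + r k / t k * meanExcess ν (w * (t k / r k))) ≤ _ ↔ _
    set E := meanExcess ν (w * (t k / r k))
    have f1 : (1 - ((j : ℝ) + 1) * β) * (w + r k / t k * E) - (1 - (j : ℝ) * β) * w =
        β * (r k / t k) * ((1 / β - ((j : ℝ) + 1)) * E - w * (t k / r k)) := by
      field_simp
      ring
    have hpos : 0 < β * (r k / t k) := by positivity
    rw [← sub_nonpos, f1, ← sub_nonpos (a := (1 / β - ((j : ℝ) + 1)) * E)]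
    exact ⟨fun h => by by_contra hcon; push Not at hcon; nlinarith [mul_pos hpos hcon],
      fun h => mul_nonpos_of_nonneg_of_nonpos hpos.le h⟩
  · simp only [hj, IsEmpty.forall_iff, iff_true]
    intro hjK
    refine stops_of_one_le (j := j) ?_ w hjK
    have h1 : ⌊1 / β⌋₊ ≤ j := by
      rw [Jmax, lt_min_iff] at hj
      by_contra hcon
      exact hj ⟨hjK, not_le.mp hcon⟩
    have h2 : 1 / β < (j : ℝ) + 1 := (Nat.lt_floor_add_one _).trans_le
      (by exact_mod_cast Nat.add_le_add_right h1 1)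
    rw [div_lt_iff₀ hβ0] at h2
    exact h2.le

end Thresholds

/-! ### The slot with equal normalized throughputs as a limit -/

section Limit

variable {K : ℕ}

theorem tendsto_finite_choice {α γ ι : Type*} [Finite ι] {l : Filter α} {m : Filter γ}
    {f : ι → α → γ} (h : ∀ i, Tendsto (f i) l m) (c : α → ι) :
    Tendsto (fun n => f (c n) n) l m := fun _ hs =>
  (eventually_all.mpr fun i => h i hs).mono fun n hn => hn (c n)

/-- The stopping rule for equal normalized throughputs: stop after `j` probes if the best
normalized rate is at least `v j`, and in any case after `J` probes. -/
def thresholdRule (J : ℕ) (v : ℕ → ℝ) (j : ℕ) (w : ℝ≥0∞) : Prop := j < J → ENNReal.ofReal (v j) ≤ w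

theorem thresholdRule_card {J : ℕ} (hJ : J ≤ K) {v : ℕ → ℝ} (w : ℝ≥0∞) :
    thresholdRule J v K w := fun h => absurd h (not_lt.mpr hJ)

/-- The number of probes under the threshold rule, if the normalized rates are `x` and the users
are probed in the order `π`. -/
def thresholdStop (J : ℕ) (v : ℕ → ℝ) (π : Equiv.Perm (Fin K)) (x : Fin K → ℝ) : ℕ :=
  firstStop (thresholdRule J v) π fun i => ENNReal.ofReal (x i)

/-- The total service under the threshold rule. -/
def thresholdGain (β : ℝ) (J : ℕ) (v : ℕ → ℝ) (π : Equiv.Perm (Fin K)) (x : Fin K → ℝ) : ℝ :=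
  (1 - (thresholdStop J v π x : ℝ) * β) *
    (best π (fun i => ENNReal.ofReal (x i)) (thresholdStop J v π x)).toReal

theorem best_mul (π : Equiv.Perm (Fin K)) (s : Fin K → ℝ≥0∞) (j : ℕ) (c : ℝ≥0∞) :
    best π s j * c = best π (fun i => s i * c) j := by
  refine Finset.apply_sup_eq_sup_comp (fun a => a * c) ?_ (by simp)
  exact fun a b => max_mul_of_nonneg a b zero_le

theorem exists_best_eq (hK : 0 < K) (π : Equiv.Perm (Fin K)) (s : Fin K → ℝ≥0∞) {j : ℕ}
    (hj : 1 ≤ j) : ∃ i : Fin K, (i : ℕ) < j ∧ best π s j = s (π i) := by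
  obtain ⟨i, hij, hi⟩ := Finset.exists_mem_eq_sup (Finset.univ.filter fun i : Fin K => (i : ℕ) < j)
    ⟨⟨0, hK⟩, by simpa using Nat.lt_of_succ_le hj⟩ (fun i => s (π i))
  exact ⟨i, by simpa using hij, hi⟩

theorem tendsto_best {α : Type*} {l : Filter α} {s : α → Fin K → ℝ≥0∞} {s' : Fin K → ℝ≥0∞}
    (h : ∀ i, Tendsto (fun n => s n i) l (𝓝 (s' i))) (π : Equiv.Perm (Fin K)) (j : ℕ) :
    Tendsto (fun n => best π (s n) j) l (𝓝 (best π s' j)) :=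
  Tendsto.finset_sup_nhds_apply fun i _ => h (π i)

variable {β : ℝ} {ν : Measure ℝ} [IsProbabilityMeasure ν] {r : Fin K → ℝ} {v : ℕ → ℝ}

theorem normRate_mul_eq {t x : Fin K → ℝ} (hr : ∀ k, 0 < r k) (ht : ∀ k, 0 < t k)
    (hx : ∀ i, 0 ≤ x i) (i : Fin K) (c : ℝ) :
    normRate t (fun i => r i * x i) i * ENNReal.ofReal c =
      ENNReal.ofReal (x i * (c / (t i / r i))) := by
  have h1 := hr i
  have h2 := ht i
  have h3 := hx i
  rw [normRate, ← ENNReal.ofReal_div_of_pos h2, ← ENNReal.ofReal_mul (by positivity)]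
  congr 1
  field_simp

theorem normRate_ne_top {t ρ : Fin K → ℝ} (ht : ∀ k, 0 < t k) (i : Fin K) :
    normRate t ρ i ≠ ∞ := by
  rw [normRate, ← ENNReal.ofReal_div_of_pos (ht i)]
  exact ENNReal.ofReal_ne_top

theorem best_ne_top {π : Equiv.Perm (Fin K)} {s : Fin K → ℝ≥0∞} (hs : ∀ i, s i ≠ ∞) (j : ℕ) :
    best π s j ≠ ∞ :=
  ((Finset.sup_lt_iff ENNReal.coe_lt_top).mpr fun i _ => (hs (π i)).lt_top).ne

/-- When the ratios of the normalized throughputs tend to one, the number of probes is eventually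
the one under the threshold rule, at every rate vector that avoids the thresholds. -/
theorem eventually_firstStop_eq (hK : 0 < K) (hβ0 : 0 < β) (hβ1 : β ≤ 1)
    (hi : Integrable (fun x : ℝ => x) ν) (hv : IsThreshold K β ν v) (hr : ∀ k, 0 < r k)
    {t : ℕ → Fin K → ℝ} (ht : ∀ᶠ n in atTop, ∀ k, 0 < t n k)
    (hratio : ∀ k l, Tendsto (fun n => (t n k / r k) / (t n l / r l)) atTop (𝓝 1))
    (π : Equiv.Perm (Fin K)) {x : Fin K → ℝ} (hx : ∀ i, 0 ≤ x i)
    (hxv : ∀ i, ∀ j ∈ Finset.Icc 1 (Jmax K β), x i ≠ v j) :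
    ∀ᶠ n in atTop, firstStop (Stops β ν r (t n) π) π (normRate (t n) fun i => r i * x i) =
      thresholdStop (Jmax K β) v π x := by
  have hagree : ∀ j ∈ Finset.Icc 1 (Jmax K β), ∀ᶠ n in atTop,
      (Stops β ν r (t n) π j (best π (normRate (t n) fun i => r i * x i) j) ↔
        thresholdRule (Jmax K β) v j (best π (fun i => ENNReal.ofReal (x i)) j)) := by
    intro j hj
    have hj1 := (Finset.mem_Icc.mp hj).1
    by_cases hjJ : j < Jmax K β
    · set m := π ⟨j, lt_card_of_lt_Jmax hjJ⟩ with hm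
      have hlim : Tendsto (fun n => best π (fun i =>
          ENNReal.ofReal (x i * ((t n m / r m) / (t n i / r i)))) j) atTop
          (𝓝 (best π (fun i => ENNReal.ofReal (x i)) j)) := by
        refine tendsto_best (fun i => ?_) π j
        have := (hratio m i).const_mul (x i)
        rw [mul_one] at this
        exact ENNReal.tendsto_ofReal this
      have hne : best π (fun i => ENNReal.ofReal (x i)) j ≠ ENNReal.ofReal (v j) := by
        obtain ⟨i, -, hi⟩ := exists_best_eq hK π (fun i => ENNReal.ofReal (x i)) hj1
        rw [hi]
        intro h
        rw [ENNReal.ofReal_eq_ofReal_iff (hx _) (hv.nonneg hβ0 hjJ.le)] at h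
        exact hxv _ j hj h
      have hev : ∀ᶠ n in atTop, (ENNReal.ofReal (v j) ≤ best π (fun i =>
          ENNReal.ofReal (x i * ((t n m / r m) / (t n i / r i)))) j ↔
          ENNReal.ofReal (v j) ≤ best π (fun i => ENNReal.ofReal (x i)) j) := by
        rcases lt_or_gt_of_ne hne with h | h
        · filter_upwards [hlim.eventually_lt_const h] with n hn
          exact ⟨fun h' => absurd hn (not_lt.mpr h'), fun h' => absurd h (not_lt.mpr h')⟩
        · filter_upwards [hlim.eventually_const_lt h] with n hn
          exact ⟨fun _ => h.le, fun _ => hn.le⟩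
      filter_upwards [ht, hev] with n hn hevn
      rw [hv.stops_iff hβ0 hi hr hn π (best_ne_top (normRate_ne_top hn) j)]
      simp only [hjJ, forall_true_left, thresholdRule, ← hm]
      rw [best_mul, ← hevn]
      simp_rw [normRate_mul_eq hr hn hx]
    · filter_upwards [ht] with n hn
      rw [hv.stops_iff hβ0 hi hr hn π (best_ne_top (normRate_ne_top hn) j)]
      simp [hjJ, thresholdRule]
  have hall := (Finset.eventually_all _).mpr hagree
  filter_upwards [hall] with n hn
  have hJ1 := one_le_Jmax hK hβ0 hβ1
  have hT : thresholdRule (Jmax K β) v (Jmax K β)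
      (best π (fun i => ENNReal.ofReal (x i)) (Jmax K β)) := fun h => absurd h (lt_irrefl _)
  rw [firstStop_eq_iff hK stops_card]
  have hle : thresholdStop (Jmax K β) v π x ≤ Jmax K β := firstStop_le hJ1 hT
  have hspec := (firstStop_eq_iff (S := thresholdRule (Jmax K β) v) (π := π)
    (s := fun i => ENNReal.ofReal (x i)) hK (thresholdRule_card Jmax_le)).mp (rfl : _ = thresholdStop (Jmax K β) v π x)
  refine ⟨⟨hspec.1.1, (hn _ (Finset.mem_Icc.mpr ⟨hspec.1.1, hle⟩)).mpr hspec.1.2⟩,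
    fun i hi hij hS => hspec.2 i hi hij ((hn i (Finset.mem_Icc.mpr ⟨hi, hij.le.trans hle⟩)).mp hS)⟩

theorem tendsto_sum_reward (hK : 0 < K) (hβ0 : 0 < β) (hβ1 : β ≤ 1)
    (hi : Integrable (fun x : ℝ => x) ν) (hv : IsThreshold K β ν v) (hr : ∀ k, 0 < r k)
    {t : ℕ → Fin K → ℝ} (ht : ∀ᶠ n in atTop, ∀ k, 0 < t n k)
    (hratio : ∀ k l, Tendsto (fun n => (t n k / r k) / (t n l / r l)) atTop (𝓝 1))
    (π : Equiv.Perm (Fin K)) {x : Fin K → ℝ} (hx : ∀ i, 0 ≤ x i)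
    (hxv : ∀ i, ∀ j ∈ Finset.Icc 1 (Jmax K β), x i ≠ v j) :
    Tendsto (fun n => ∑ k, reward β ν r (t n) π x k) atTop
      (𝓝 (thresholdGain β (Jmax K β) v π x)) := by
  set J := thresholdStop (Jmax K β) v π x with hJ
  set m : Fin K := ⟨0, hK⟩
  choose c hc using fun n => exists_isSelected (S := Stops β ν r (t n) π) (π := π)
    (s := normRate (t n) fun i => r i * x i) hK stops_card
  have hlim : Tendsto (fun n => best π (fun i =>
      ENNReal.ofReal (x i * ((t n m / r m) / (t n i / r i)))) J) atTop
      (𝓝 (best π (fun i => ENNReal.ofReal (x i)) J)) := by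
    refine tendsto_best (fun i => ?_) π J
    have := (hratio m i).const_mul (x i)
    rw [mul_one] at this
    exact ENNReal.tendsto_ofReal this
  have hlim' := (ENNReal.tendsto_toReal (best_ne_top (fun i => ENNReal.ofReal_ne_top) J)).comp hlim
  have hc1 : Tendsto (fun n => (t n (c n) / r (c n)) / (t n m / r m)) atTop (𝓝 1) :=
    tendsto_finite_choice (f := fun k n => (t n k / r k) / (t n m / r m)) (fun k => hratio k m) c
  have hprod := (hlim'.mul hc1).const_mul (1 - (J : ℝ) * β)
  rw [mul_one] at hprod
  refine hprod.congr' ?_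
  filter_upwards [ht, eventually_firstStop_eq hK hβ0 hβ1 hi hv hr ht hratio π hx hxv] with n hn hJn
  rw [sum_reward_eq (hc n), hJn, ← hJ]
  congr 1
  -- the selected rate is the best normalized rate times the throughput of the selected user
  have h1 : normRate (t n) (fun i => r i * x i) (c n) =
      best π (normRate (t n) fun i => r i * x i) J := by rw [(hc n).2.1, hJn]
  have h2 := congrArg (fun a => a * ENNReal.ofReal (t n m / r m)) h1
  simp only [best_mul, normRate_mul_eq hr hn hx] at h2
  have p1 : 0 < t n m / r m := div_pos (hn _) (hr _)
  have p2 : 0 < t n (c n) / r (c n) := div_pos (hn _) (hr _)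
  simp only [Function.comp_apply]
  rw [← h2, ENNReal.toReal_ofReal (mul_nonneg (hx _) (by positivity)), mul_assoc,
    div_mul_div_cancel₀ p2.ne', div_self p1.ne', mul_one]

theorem measurable_thresholdStop (hK : 0 < K) {J : ℕ} (hJ : J ≤ K) (π : Equiv.Perm (Fin K)) :
    Measurable fun x : Fin K → ℝ => thresholdStop J v π x := by
  refine measurable_to_countable' fun j => ?_
  have hset : ∀ i, MeasurableSet {x : Fin K → ℝ |
      thresholdRule J v i (best π (fun k => ENNReal.ofReal (x k)) i)} := fun i => by
    have h2 : Measurable fun x : Fin K → ℝ => fun k => ENNReal.ofReal (x k) := by fun_prop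
    have hb : Measurable fun x : Fin K → ℝ => best π (fun k => ENNReal.ofReal (x k)) i :=
      (measurable_best π i).comp h2
    by_cases h : i < J
    · simpa only [thresholdRule, h, forall_true_left] using measurableSet_le measurable_const hb
    · simp [thresholdRule, h]
  have : (fun x : Fin K → ℝ => thresholdStop J v π x) ⁻¹' {j} =
      ({x | 1 ≤ j} ∩ {x | thresholdRule J v j (best π (fun k => ENNReal.ofReal (x k)) j)}) ∩
        ⋂ i, ⋂ (_ : 1 ≤ i), ⋂ (_ : i < j),
          {x | thresholdRule J v i (best π (fun k => ENNReal.ofReal (x k)) i)}ᶜ := by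
    ext x
    simp only [Set.mem_preimage, Set.mem_singleton_iff, thresholdStop,
      firstStop_eq_iff hK (thresholdRule_card hJ)]
    simp
  rw [this]
  exact ((MeasurableSet.const _).inter (hset j)).inter
    (MeasurableSet.iInter fun i => MeasurableSet.iInter fun _ => MeasurableSet.iInter fun _ =>
      (hset i).compl)

theorem measurable_thresholdGain (hK : 0 < K) {J : ℕ} (hJ : J ≤ K) (π : Equiv.Perm (Fin K)) :
    Measurable fun x : Fin K → ℝ => thresholdGain β J v π x := by
  have h1 := measurable_thresholdStop (v := v) hK hJ π
  have h2 : Measurable fun x : Fin K → ℝ => fun k => ENNReal.ofReal (x k) := by fun_prop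
  have hb : Measurable fun x : Fin K → ℝ =>
      best π (fun k => ENNReal.ofReal (x k)) (thresholdStop J v π x) :=
    (measurable_from_prod_countable_left (f := fun p : (Fin K → ℝ) × ℕ =>
      best π (fun k => ENNReal.ofReal (p.1 k)) p.2)
      fun j => (measurable_best π j).comp h2).comp (measurable_id.prodMk h1)
  have h3 : Measurable fun x : Fin K → ℝ => (thresholdStop J v π x : ℝ) :=
    (measurable_from_nat (f := fun n : ℕ => (n : ℝ))).comp h1
  exact ((h3.mul_const β).const_sub 1).mul hb.ennreal_toReal

theorem integral_comp_perm (π : Equiv.Perm (Fin K)) {f : (Fin K → ℝ) → ℝ} (hf : Measurable f) :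
    ∫ x, f (x ∘ π) ∂(Measure.pi fun _ : Fin K => ν) = ∫ x, f x ∂(Measure.pi fun _ => ν) := by
  have hmp := measurePreserving_comp_injective (ν := ν) π.injective
  conv_rhs => rw [← hmp.map_eq]
  exact (integral_map (f := f) hmp.measurable.aemeasurable hf.aestronglyMeasurable).symm

theorem ae_pi_ne {s : Finset ℕ} (hs : ∀ j ∈ s, ν {v j} = 0) :
    ∀ᵐ x ∂(Measure.pi fun _ : Fin K => ν), ∀ i, ∀ j ∈ s, x i ≠ v j := by
  rw [ae_all_iff]
  intro i
  refine (measurePreserving_eval (fun _ : Fin K => ν) i).quasiMeasurePreserving.ae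
    (p := fun y => ∀ j ∈ s, y ≠ v j) ?_
  refine (Finset.eventually_all s).mpr fun j hj => ?_
  rw [ae_iff]
  simpa using hs j hj

/-- As the ratios of the normalized throughputs tend to one, the total mean service tends to that
of the threshold rule, whatever the probing orders are. -/
theorem tendsto_sum_integral_reward (hK : 0 < K) (hβ0 : 0 < β) (hβ1 : β ≤ 1)
    (h0 : ∀ᵐ x ∂ν, 0 ≤ x) (hi : Integrable (fun x : ℝ => x) ν) (hv : IsThreshold K β ν v)
    (hν : ∀ j ∈ Finset.Icc 1 (Jmax K β), ν {v j} = 0) (hr : ∀ k, 0 < r k)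
    {t : ℕ → Fin K → ℝ} (ht : ∀ᶠ n in atTop, ∀ k, 0 < t n k)
    (hratio : ∀ k l, Tendsto (fun n => (t n k / r k) / (t n l / r l)) atTop (𝓝 1))
    (c : ℕ → Equiv.Perm (Fin K)) :
    Tendsto (fun n => ∑ k, ∫ x, reward β ν r (t n) (c n) x k ∂(Measure.pi fun _ : Fin K => ν))
      atTop (𝓝 (∫ x, thresholdGain β (Jmax K β) v (Equiv.refl _) x
        ∂(Measure.pi fun _ : Fin K => ν))) := by
  refine tendsto_finite_choice (f := fun π n => ∑ k, ∫ x, reward β ν r (t n) π x k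
    ∂(Measure.pi fun _ : Fin K => ν)) (fun π => ?_) c
  rw [← integral_comp_perm π (measurable_thresholdGain hK Jmax_le _)]
  simp_rw [← integral_finsetSum Finset.univ fun k _ => integrable_reward hK hβ0 hβ1 hi π k]
  refine tendsto_integral_of_dominated_convergence (fun x => ∑ k, |x k|) (fun n => ?_)
    (integrable_finsetSum _ fun k _ => integrable_abs_apply hi k) (fun n => ?_) ?_
  · exact (integrable_finsetSum _ fun k _ =>
      integrable_reward hK hβ0 hβ1 hi π k).aestronglyMeasurable
  · exact Eventually.of_forall fun x => (norm_sum_le _ _).trans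
      (Finset.sum_le_sum fun k _ => abs_reward_le hK hβ0 hβ1 k)
  · filter_upwards [ae_pi_nonneg h0, ae_pi_ne hν] with x hx hxv
    exact tendsto_sum_reward hK hβ0 hβ1 hi hv hr ht hratio π hx hxv

theorem tendsto_integral_firstStop (hK : 0 < K) (hβ0 : 0 < β) (hβ1 : β ≤ 1)
    (h0 : ∀ᵐ x ∂ν, 0 ≤ x) (hi : Integrable (fun x : ℝ => x) ν) (hv : IsThreshold K β ν v)
    (hν : ∀ j ∈ Finset.Icc 1 (Jmax K β), ν {v j} = 0) (hr : ∀ k, 0 < r k)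
    {t : ℕ → Fin K → ℝ} (ht : ∀ᶠ n in atTop, ∀ k, 0 < t n k)
    (hratio : ∀ k l, Tendsto (fun n => (t n k / r k) / (t n l / r l)) atTop (𝓝 1))
    (c : ℕ → Equiv.Perm (Fin K)) (j : ℕ) :
    Tendsto (fun n => ∫ x, (if firstStop (Stops β ν r (t n) (c n)) (c n)
        (normRate (t n) fun i => r i * x i) = j then (1 : ℝ) else 0)
        ∂(Measure.pi fun _ : Fin K => ν))
      atTop (𝓝 (∫ x, (if thresholdStop (Jmax K β) v (Equiv.refl _) x = j then (1 : ℝ) else 0)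
        ∂(Measure.pi fun _ : Fin K => ν))) := by
  refine tendsto_finite_choice (f := fun π n => ∫ x, (if firstStop (Stops β ν r (t n) π) π
        (normRate (t n) fun i => r i * x i) = j then (1 : ℝ) else 0)
        ∂(Measure.pi fun _ : Fin K => ν)) (fun π => ?_) c
  have hm : Measurable fun x : Fin K → ℝ =>
      if thresholdStop (Jmax K β) v (Equiv.refl _) x = j then (1 : ℝ) else 0 :=
    Measurable.ite (measurable_thresholdStop hK Jmax_le _ (measurableSet_singleton j))
      measurable_const measurable_const
  rw [← integral_comp_perm π hm]
  refine tendsto_integral_of_dominated_convergence (fun _ => 1) (fun n => ?_)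
    (integrable_const _) (fun n => ?_) ?_
  · have h1 := (measurable_firstStop (β := β) (ν := ν) (r := r) hK π).comp
      (measurable_mul_rates (r := r))
    have h2 := h1.comp (measurable_prodMk_left (x := t n))
    exact (Measurable.ite (h2 (measurableSet_singleton j)) measurable_const
      measurable_const).aestronglyMeasurable
  · exact Eventually.of_forall fun x => by split_ifs <;> simp
  · filter_upwards [ae_pi_nonneg h0, ae_pi_ne hν] with x hx hxv
    refine tendsto_const_nhds.congr' ?_
    filter_upwards [eventually_firstStop_eq hK hβ0 hβ1 hi hv hr ht hratio π hx hxv] with n hn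
    rw [hn]
    rfl

end Limit

/-! ### The scheduling gain of the threshold rule -/

section Formula

variable {ν : Measure ℝ} [IsProbabilityMeasure ν]

/-- Conditioning the coordinates of an i.i.d. family separately is conditioning on a box. -/
theorem pi_cond_eq_cond_pi {ι : Type*} [Fintype ι] {s : ι → Set ℝ}
    (hs : ∀ i, MeasurableSet (s i)) :
    Measure.pi (fun i => ProbabilityTheory.cond ν (s i)) =
      ProbabilityTheory.cond (Measure.pi fun _ : ι => ν) (Set.univ.pi s) := by
  refine Measure.pi_eq fun t _ => ?_
  rw [cond_apply (MeasurableSet.univ_pi hs), ← Set.pi_inter_distrib, Measure.pi_pi,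
    Measure.pi_pi]
  simp_rw [cond_apply (hs _)]
  rw [Finset.prod_mul_distrib, ENNReal.prod_inv_distrib]
  exact fun i _ j _ _ => Or.inr (measure_ne_top _ _)

/-- The box on which all coordinates but the last lie in `[0, b]`. -/
def initBox (b : ℝ) (j : ℕ) : Set (Fin j → ℝ) :=
  Set.univ.pi fun i : Fin j => if (i : ℕ) + 1 < j then Set.Icc 0 b else Set.univ

/-- The vectors in `initBox b j` whose largest coordinate is at least `a`. -/
def stopRegion (a b : ℝ) (j : ℕ) : Set (Fin j → ℝ) := initBox b j ∩ {y | a ≤ ⨆ i, y i}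

theorem measurableSet_initBox (b : ℝ) (j : ℕ) : MeasurableSet (initBox b j) :=
  MeasurableSet.univ_pi fun i => by split_ifs <;> measurability

theorem measurable_iSup_apply (j : ℕ) : Measurable fun y : Fin j → ℝ => ⨆ i, y i :=
  Measurable.iSup fun i => measurable_pi_apply i

theorem measurableSet_stopRegion (a b : ℝ) (j : ℕ) : MeasurableSet (stopRegion a b j) :=
  (measurableSet_initBox b j).inter (measurableSet_le measurable_const (measurable_iSup_apply j))

theorem measureReal_Icc_zero (h0 : ∀ᵐ x ∂ν, 0 ≤ x) (b : ℝ) :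
    ν.real (Set.Icc 0 b) = cdf ν b := by
  rw [cdf_eq_real]
  refine measureReal_congr ?_
  filter_upwards [h0] with x hx
  exact propext ⟨fun h => h.2, fun h => ⟨hx, h⟩⟩

theorem measureReal_Iio_of_null {a : ℝ} (ha : ν {a} = 0) : ν.real (Set.Iio a) = cdf ν a := by
  rw [cdf_eq_real]
  refine measureReal_congr ?_
  have h : ∀ᵐ x ∂ν, x ≠ a := by
    rw [ae_iff]
    simpa using ha
  filter_upwards [h] with x hx
  exact propext ⟨fun h => le_of_lt h, fun h => lt_of_le_of_ne h hx⟩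

theorem measureReal_initBox (h0 : ∀ᵐ x ∂ν, 0 ≤ x) (b : ℝ) (m : ℕ) :
    (Measure.pi fun _ : Fin (m + 1) => ν).real (initBox b (m + 1)) = cdf ν b ^ m := by
  rw [measureReal_def, initBox, Measure.pi_pi, ENNReal.toReal_prod, Fin.prod_univ_castSucc]
  simp [← measureReal_def, measureReal_Icc_zero h0]

theorem measureReal_stopRegion (h0 : ∀ᵐ x ∂ν, 0 ≤ x) {a b : ℝ} (hab : a ≤ b) (ha : ν {a} = 0)
    (m : ℕ) : (Measure.pi fun _ : Fin (m + 1) => ν).real (stopRegion a b (m + 1)) =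
      cdf ν b ^ m - cdf ν a ^ (m + 1) := by
  set P := Measure.pi fun _ : Fin (m + 1) => ν
  have h1 := measureReal_inter_add_sdiff (μ := P) (s := initBox b (m + 1))
    (t := {y | a ≤ ⨆ i, y i}) (measurableSet_le measurable_const (measurable_iSup_apply _))
  have h2 : P.real (initBox b (m + 1) \ {y | a ≤ ⨆ i, y i}) = cdf ν a ^ (m + 1) := by
    have : P.real (Set.univ.pi fun _ : Fin (m + 1) => Set.Iio a) = cdf ν a ^ (m + 1) := by
      rw [measureReal_def, Measure.pi_pi, ENNReal.toReal_prod]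
      simp [← measureReal_def, measureReal_Iio_of_null ha]
    rw [← this]
    refine measureReal_congr ?_
    filter_upwards [ae_pi_nonneg (K := m + 1) h0] with y hy
    have hlt : (⨆ i, y i) < a ↔ ∀ i, y i < a := by
      constructor
      · exact fun h i => (le_ciSup (Set.finite_range y).bddAbove i).trans_lt h
      · intro h
        obtain ⟨i, hi⟩ := exists_eq_ciSup_of_finite (f := y)
        rw [← hi]
        exact h i
    refine propext ⟨fun h i _ => hlt.mp (not_le.mp h.2) i, fun h => ⟨fun i _ => ?_,
      not_le.mpr (hlt.mpr fun i => h i trivial)⟩⟩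
    simp only
    split_ifs
    · exact ⟨hy i, (le_of_lt (h i trivial)).trans hab⟩
    · trivial
  rw [h2, measureReal_initBox h0] at h1
  rw [stopRegion]
  linarith

theorem integral_cond {α : Type*} [MeasurableSpace α] (μ : Measure α) (s : Set α) (f : α → ℝ) :
    ∫ x, f x ∂(ProbabilityTheory.cond μ s) = (μ.real s)⁻¹ * ∫ x in s, f x ∂μ := by
  rw [ProbabilityTheory.cond, integral_smul_measure, measureReal_def, smul_eq_mul,
    ENNReal.toReal_inv]

/-- The `j`-th term of the gain formula, without the factor `1 - j β`, is the mean of the largest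
coordinate over the stop region. -/
theorem probeProb_mul_truncMaxMean (h0 : ∀ᵐ x ∂ν, 0 ≤ x) {v : ℕ → ℝ} {m : ℕ}
    (hab : v (m + 1) ≤ v m) (ha : ν {v (m + 1)} = 0) :
    probeProb ν v (m + 1) * truncMaxMean ν v (m + 1) =
      ∫ y in stopRegion (v (m + 1)) (v m) (m + 1), (⨆ i, y i)
        ∂(Measure.pi fun _ : Fin (m + 1) => ν) := by
  have hq := measureReal_stopRegion h0 hab ha m
  have hp : probeProb ν v (m + 1) = (Measure.pi fun _ : Fin (m + 1) => ν).real
      (stopRegion (v (m + 1)) (v m) (m + 1)) := by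
    rw [hq, probeProb, Nat.add_sub_cancel]
  set Q := Measure.pi fun _ : Fin (m + 1) => ν
  set A := initBox (v m) (m + 1)
  have hA : MeasurableSet A := measurableSet_initBox _ _
  have hsup := measurable_iSup_apply (m + 1)
  set E : Set (Fin (m + 1) → ℝ) := {y | v (m + 1) ≤ ⨆ i, y i} with hE
  have hEm : MeasurableSet E := measurableSet_le measurable_const hsup
  have hmax : maxLaw ν (v m) (m + 1) = (ProbabilityTheory.cond Q A).map fun y => ⨆ i, y i := by
    rw [maxLaw]
    congr 1
    have := pi_cond_eq_cond_pi (ν := ν)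
      (s := fun i : Fin (m + 1) => if (i : ℕ) + 1 < m + 1 then Set.Icc 0 (v m) else Set.univ)
      (fun i => by split_ifs <;> measurability)
    refine Eq.trans ?_ this
    congr 1
    ext1 i
    split_ifs
    · rfl
    · rw [cond_univ]
  rw [hp, truncMaxMean, Nat.add_sub_cancel, hmax, integral_cond,
    setIntegral_map (f := fun x : ℝ => x) measurableSet_Ici aestronglyMeasurable_id hsup.aemeasurable,
    map_measureReal_apply hsup measurableSet_Ici]
  have hpre : (fun y : Fin (m + 1) → ℝ => ⨆ i, y i) ⁻¹' Set.Ici (v (m + 1)) = E := rfl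
  have hcond : (ProbabilityTheory.cond Q A).real E = (Q.real A)⁻¹ * Q.real (A ∩ E) := by
    rw [measureReal_def, cond_apply hA, ENNReal.toReal_mul, ENNReal.toReal_inv]
    rfl
  rw [hpre, hcond, ← integral_indicator hEm, integral_cond,
    setIntegral_indicator hEm]
  change Q.real (A ∩ E) * _ = ∫ y in A ∩ E, _ ∂Q
  by_cases hz : Q.real (A ∩ E) = 0
  · rw [hz, zero_mul]
    have : Q (A ∩ E) = 0 := (measureReal_eq_zero_iff (measure_ne_top _ _)).mp hz
    exact (setIntegral_measure_zero _ this).symm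
  · have hA0 : Q.real A ≠ 0 := fun h => hz (le_antisymm
      (h ▸ measureReal_mono Set.inter_subset_left) measureReal_nonneg)
    field_simp

variable {K : ℕ} {β : ℝ} {v : ℕ → ℝ}

theorem best_refl_eq_iSup {x : Fin K → ℝ} {j : ℕ} (hj1 : 1 ≤ j) (hj : j ≤ K) :
    best (Equiv.refl _) (fun i => ENNReal.ofReal (x i)) j =
      ENNReal.ofReal (⨆ i : Fin j, x (Fin.castLE hj i)) := by
  have : Nonempty (Fin j) := ⟨⟨0, hj1⟩⟩
  have hbdd : BddAbove (Set.range fun i : Fin j => x (Fin.castLE hj i)) :=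
    (Set.finite_range _).bddAbove
  refine le_antisymm (best_le fun i hi => ?_) ?_
  · exact ENNReal.ofReal_le_ofReal (le_ciSup hbdd ⟨i, hi⟩)
  · obtain ⟨i, hi⟩ := exists_eq_ciSup_of_finite (f := fun i : Fin j => x (Fin.castLE hj i))
    rw [← hi]
    exact le_best (π := Equiv.refl _) (s := fun i => ENNReal.ofReal (x i)) (i := Fin.castLE hj i)
      i.isLt

/-- The event that the threshold rule makes `m + 1` probes: the first `m` rates are below the
threshold `v m`, and the best of the first `m + 1` rates reaches `v (m + 1)`. Earlier thresholds
impose no further condition, since the thresholds decrease. -/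
theorem thresholdStop_eq_iff (hβ0 : 0 < β) (hi : Integrable (fun x : ℝ => x) ν)
    (hv : IsThreshold K β ν v) {x : Fin K → ℝ} (hx : ∀ i, 0 ≤ x i)
    (hxv : ∀ i, ∀ j ∈ Finset.Icc 1 (Jmax K β), x i ≠ v j) {m : ℕ} (hm : m + 1 ≤ Jmax K β) :
    thresholdStop (Jmax K β) v (Equiv.refl _) x = m + 1 ↔
      x ∘ Fin.castLE (hm.trans Jmax_le) ∈ stopRegion (v (m + 1)) (v m) (m + 1) := by
  have hmK := hm.trans (Jmax_le (K := K) (β := β))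
  have hK : 0 < K := by omega
  rw [thresholdStop, firstStop_eq_iff hK (thresholdRule_card Jmax_le), stopRegion,
    Set.mem_inter_iff, and_comm]
  refine and_congr ?_ ?_
  · constructor
    · intro h i _
      simp only
      split_ifs with him
      · have him' : (i : ℕ) < m := by omega
        have h1 := h m (by omega) (by omega)
        simp only [thresholdRule, Classical.not_imp, not_le] at h1
        refine ⟨hx _, ?_⟩
        by_contra hcon
        push Not at hcon
        refine absurd h1.2 (not_lt.mpr ((ENNReal.ofReal_le_ofReal hcon.le).trans ?_))
        exact le_best (π := Equiv.refl _) (s := fun i => ENNReal.ofReal (x i))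
          (i := Fin.castLE hmK i) him'
      · trivial
    · intro h i hi1 him hrule
      have h1 := hrule (by omega)
      obtain ⟨p, hp, hbest⟩ := exists_best_eq hK (Equiv.refl _)
        (fun i => ENNReal.ofReal (x i)) hi1
      rw [hbest, ENNReal.ofReal_le_ofReal_iff (hx _)] at h1
      have h2 := h ⟨p, by omega⟩ trivial
      simp only at h2
      rw [if_pos (by omega)] at h2
      have h3 : x p ≤ v m := h2.2
      have h4 := hv.anti hβ0 hi (show i ≤ m by omega) (by omega)
      exact hxv p m (Finset.mem_Icc.mpr ⟨by omega, by omega⟩) (le_antisymm h3 (h4.trans h1))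
  · rw [thresholdRule, best_refl_eq_iSup (by omega) hmK]
    have hsup0 : 0 ≤ ⨆ i : Fin (m + 1), x (Fin.castLE hmK i) := Real.iSup_nonneg fun i => hx _
    rw [ENNReal.ofReal_le_ofReal_iff hsup0]
    constructor
    · rintro ⟨-, h⟩
      change v (m + 1) ≤ ⨆ i : Fin (m + 1), x (Fin.castLE hmK i)
      rcases hm.lt_or_eq with h' | h'
      · exact h h'
      · have h0 : v (m + 1) = 0 := by rw [h', hv.2]
        rwa [h0]
    · exact fun h => ⟨by omega, fun _ => h⟩

theorem integral_thresholdStop_eq (hβ0 : 0 < β) (h0 : ∀ᵐ x ∂ν, 0 ≤ x)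
    (hi : Integrable (fun x : ℝ => x) ν) (hv : IsThreshold K β ν v)
    (hν : ∀ j ∈ Finset.Icc 1 (Jmax K β), ν {v j} = 0) {j : ℕ}
    (hj : j ∈ Finset.Icc 1 (Jmax K β)) :
    ∫ x, (if thresholdStop (Jmax K β) v (Equiv.refl _) x = j then (1 : ℝ) else 0)
      ∂(Measure.pi fun _ : Fin K => ν) = probeProb ν v j := by
  obtain ⟨hj1, hjJ⟩ := Finset.mem_Icc.mp hj
  obtain ⟨m, rfl⟩ : ∃ m, j = m + 1 := ⟨j - 1, by omega⟩
  have hmp := measurePreserving_comp_injective (ν := ν)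
    (Fin.castLE_injective (hjJ.trans (Jmax_le (K := K) (β := β))))
  have hR := measurableSet_stopRegion (v (m + 1)) (v m) (m + 1)
  rw [probeProb, Nat.add_sub_cancel, ← measureReal_stopRegion h0 (hv.succ_le hβ0 hi hjJ) (hν _ hj),
    ← integral_indicator_one hR]
  conv_rhs => rw [← hmp.map_eq]
  rw [integral_map hmp.measurable.aemeasurable
    (measurable_one.indicator hR).aestronglyMeasurable]
  refine integral_congr_ae ?_
  filter_upwards [ae_pi_nonneg h0, ae_pi_ne hν] with x hx hxv
  classical
  exact if_congr (thresholdStop_eq_iff hβ0 hi hv hx hxv hjJ) rfl rfl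

/-- The mean service of the threshold rule is the sum in the gain formula. -/
theorem integral_thresholdGain_eq (hK : 0 < K) (hβ0 : 0 < β) (hβ1 : β ≤ 1) (h0 : ∀ᵐ x ∂ν, 0 ≤ x)
    (hi : Integrable (fun x : ℝ => x) ν) (hv : IsThreshold K β ν v)
    (hν : ∀ j ∈ Finset.Icc 1 (Jmax K β), ν {v j} = 0) :
    ∫ x, thresholdGain β (Jmax K β) v (Equiv.refl _) x ∂(Measure.pi fun _ : Fin K => ν) =
      ∑ j ∈ Finset.Icc 1 (Jmax K β), probeProb ν v j * (1 - (j : ℝ) * β) * truncMaxMean ν v j := by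
  set J := Jmax K β with hJ
  set W : ℕ → (Fin K → ℝ) → ℝ := fun j x =>
    if thresholdStop J v (Equiv.refl _) x = j then
      (best (Equiv.refl _) (fun i => ENNReal.ofReal (x i)) j).toReal else 0 with hW
  have hWm : ∀ j, Measurable (W j) := fun j => by
    have h2 : Measurable fun x : Fin K → ℝ => fun k => ENNReal.ofReal (x k) := by fun_prop
    exact Measurable.ite (measurable_thresholdStop hK Jmax_le _ (measurableSet_singleton j))
      ((measurable_best _ j).comp h2).ennreal_toReal measurable_const
  have hWi : ∀ j ∈ Finset.Icc 1 J, Integrable (W j) (Measure.pi fun _ : Fin K => ν) := by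
    intro j hj
    refine (integrable_finsetSum Finset.univ fun k _ => integrable_abs_apply hi k).mono'
      (hWm j).aestronglyMeasurable (Eventually.of_forall fun x => ?_)
    have hpos : 0 ≤ ∑ k, |x k| := Finset.sum_nonneg fun k _ => abs_nonneg _
    simp only [hW]
    split_ifs
    · obtain ⟨i, -, hb⟩ := exists_best_eq hK (Equiv.refl _) (fun i => ENNReal.ofReal (x i))
        (Finset.mem_Icc.mp hj).1
      rw [hb, Real.norm_eq_abs, abs_of_nonneg ENNReal.toReal_nonneg, ENNReal.toReal_ofReal']
      exact (max_le (le_abs_self _) (abs_nonneg _)).trans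
        (Finset.single_le_sum (f := fun k => |x k|) (fun k _ => abs_nonneg _) (Finset.mem_univ i))
    · simpa using hpos
  have hterm : ∀ j ∈ Finset.Icc 1 J, ∫ x, W j x ∂(Measure.pi fun _ : Fin K => ν) =
      probeProb ν v j * truncMaxMean ν v j := by
    intro j hj
    obtain ⟨hj1, hjJ⟩ := Finset.mem_Icc.mp hj
    obtain ⟨m, rfl⟩ : ∃ m, j = m + 1 := ⟨j - 1, by omega⟩
    have hjK := hjJ.trans (Jmax_le (K := K) (β := β))
    have hmp := measurePreserving_comp_injective (ν := ν) (Fin.castLE_injective hjK)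
    have hR := measurableSet_stopRegion (v (m + 1)) (v m) (m + 1)
    rw [probeProb_mul_truncMaxMean h0 (hv.succ_le hβ0 hi hjJ) (hν _ hj), ← integral_indicator hR]
    conv_rhs => rw [← hmp.map_eq]
    rw [integral_map hmp.measurable.aemeasurable
      ((measurable_iSup_apply (m + 1)).indicator hR).aestronglyMeasurable]
    refine integral_congr_ae ?_
    filter_upwards [ae_pi_nonneg h0, ae_pi_ne hν] with x hx hxv
    have hiff := thresholdStop_eq_iff hβ0 hi hv hx hxv hjJ
    simp only [hW, Set.indicator, ← hiff]
    rw [best_refl_eq_iSup hj1 hjK, ENNReal.toReal_ofReal (Real.iSup_nonneg fun i => hx _)]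
    rfl
  have hsplit : ∀ x : Fin K → ℝ, thresholdGain β J v (Equiv.refl _) x =
      ∑ j ∈ Finset.Icc 1 J, (1 - (j : ℝ) * β) * W j x := by
    intro x
    have hle : thresholdStop J v (Equiv.refl _) x ≤ J :=
      firstStop_le (one_le_Jmax hK hβ0 hβ1) fun h => absurd h (lt_irrefl _)
    have hge : 1 ≤ thresholdStop J v (Equiv.refl _) x :=
      (firstStop_spec hK (thresholdRule_card Jmax_le)).1
    rw [Finset.sum_eq_single (thresholdStop J v (Equiv.refl _) x)]
    · simp [hW, thresholdGain]
    · intro j _ hne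
      simp [hW, hne.symm]
    · intro h
      exact absurd (Finset.mem_Icc.mpr ⟨hge, hle⟩) h
  simp_rw [hsplit]
  rw [integral_finsetSum _ fun j hj => (hWi j hj).const_mul _]
  refine Finset.sum_congr rfl fun j hj => ?_
  rw [integral_const_mul, hterm j hj]
  ring

end Formula

/-! ### Equalization of averages under a restoring drift -/

section Deterministic

theorem exists_abs_le_mul_add {M : ℕ → ℝ} (hM : Tendsto (fun n : ℕ => M n / n) atTop (𝓝 0))
    {ε : ℝ} (hε : 0 < ε) : ∃ A, 0 ≤ A ∧ ∀ n : ℕ, |M n| ≤ ε * n + A := by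
  obtain ⟨N, hN⟩ := eventually_atTop.mp
    ((Metric.tendsto_nhds.mp hM ε hε).and (eventually_gt_atTop 0))
  refine ⟨∑ m ∈ Finset.range N, |M m|, Finset.sum_nonneg fun _ _ => abs_nonneg _, fun n => ?_⟩
  have hA : 0 ≤ ∑ m ∈ Finset.range N, |M m| := Finset.sum_nonneg fun _ _ => abs_nonneg _
  rcases lt_or_ge n N with h | h
  · have h1 := Finset.single_le_sum (f := fun m => |M m|) (fun _ _ => abs_nonneg _)
      (Finset.mem_range.mpr h)
    have : 0 ≤ ε * n := by positivity
    linarith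
  · obtain ⟨h1, h2⟩ := hN n h
    have hn : (0 : ℝ) < n := by exact_mod_cast h2
    rw [Real.dist_eq, sub_zero, abs_div, abs_of_pos hn, div_lt_iff₀ hn] at h1
    linarith

/-- A sum whose compensator `h` is nonpositive whenever the sum is positive cannot grow linearly:
since its last nonpositive value it has only been raised by one step and by the noise. -/
theorem eventually_sum_div_le {b h : ℕ → ℝ} {C : ℝ}
    (hM : Tendsto (fun n : ℕ => (∑ j ∈ Finset.range n, (b j - h j)) / n) atTop (𝓝 0))
    (hC : ∀ n, h n ≤ C) (hC0 : 0 ≤ C)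
    (hdrift : ∀ n, 0 < ∑ j ∈ Finset.range n, b j → h n ≤ 0) {ε : ℝ} (hε : 0 < ε) :
    ∀ᶠ n : ℕ in atTop, (∑ j ∈ Finset.range n, b j) / n ≤ ε := by
  obtain ⟨A, hA0, hA⟩ := exists_abs_le_mul_add hM (show 0 < ε / 3 by positivity)
  have hcomp : ∀ n : ℕ, ∑ j ∈ Finset.range n, h j ≤ C + A + ε / 3 * n := by
    intro n
    induction n with
    | zero => simp; linarith
    | succ n ih =>
      rw [Finset.sum_range_succ]
      push_cast
      by_cases hpos : 0 < ∑ j ∈ Finset.range n, b j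
      · have := hdrift n hpos
        nlinarith
      · have h1 := hA n
        rw [Finset.sum_sub_distrib, abs_le] at h1
        have h2 := hC n
        push Not at hpos
        nlinarith [h1.1]
  filter_upwards [eventually_gt_atTop 0, eventually_ge_atTop ⌈(C + 2 * A) * 3 / ε⌉₊] with n hn hn'
  have hn0 : (0 : ℝ) < n := by exact_mod_cast hn
  have h1 := (abs_le.mp (hA n)).2
  rw [Finset.sum_sub_distrib] at h1
  have h2 := hcomp n
  have h3 : (C + 2 * A) * 3 / ε ≤ n := (Nat.le_ceil _).trans (by exact_mod_cast hn')
  rw [div_le_iff₀ hε] at h3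
  rw [div_le_iff₀ hn0]
  linarith

variable {K : ℕ} {τ b H : ℕ → Fin K → ℝ} {δ : ℝ}

theorem tendsto_sub_of_drift (hτ : ∀ (n : ℕ) k, (n : ℝ) * τ n k = ∑ j ∈ Finset.range n, b j k)
    (hM : ∀ k, Tendsto (fun n : ℕ => (∑ j ∈ Finset.range n, (b j k - H j k)) / n) atTop (𝓝 0))
    (hH : ∀ n k, |H n k| ≤ 1) (hdrift : ∀ n k l, τ n k < τ n l → H n l ≤ H n k) (k l : Fin K) :
    Tendsto (fun n => τ n l - τ n k) atTop (𝓝 0) := by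
  have main : ∀ k l : Fin K, ∀ ε > 0, ∀ᶠ n in atTop, τ n l - τ n k ≤ ε := by
    intro k l ε hε
    have h1 := eventually_sum_div_le (b := fun j => b j l - b j k) (h := fun j => H j l - H j k)
      (C := 2) (by
        have := (hM l).sub (hM k)
        rw [sub_zero] at this
        refine this.congr fun n => ?_
        rw [← sub_div, ← Finset.sum_sub_distrib]
        congr 1
        exact Finset.sum_congr rfl fun j _ => by ring)
      (fun n => by
        have h1 := (abs_le.mp (hH n l)).2
        have h2 := (abs_le.mp (hH n k)).1
        linarith) (by norm_num)
      (fun n hpos => by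
        rw [Finset.sum_sub_distrib, ← hτ, ← hτ, ← mul_sub] at hpos
        have := pos_of_mul_pos_right hpos (Nat.cast_nonneg n)
        linarith [hdrift n k l (by linarith)]) hε
    filter_upwards [h1, eventually_gt_atTop 0] with n hn hn0
    have hn1 : (n : ℝ) ≠ 0 := by positivity
    rw [Finset.sum_sub_distrib, ← hτ, ← hτ, ← mul_sub, mul_div_cancel_left₀ _ hn1] at hn
    exact hn
  rw [Metric.tendsto_nhds]
  intro ε hε
  filter_upwards [main k l (ε / 2) (by positivity), main l k (ε / 2) (by positivity)] with n h1 h2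
  rw [Real.dist_eq, sub_zero, abs_lt]
  constructor <;> linarith

theorem tendsto_sum_sub_average (hτ : ∀ (n : ℕ) k, (n : ℝ) * τ n k = ∑ j ∈ Finset.range n, b j k)
    (hM : ∀ k, Tendsto (fun n : ℕ => (∑ j ∈ Finset.range n, (b j k - H j k)) / n)
      atTop (𝓝 0)) :
    Tendsto (fun n : ℕ => ∑ k, τ n k - (n : ℝ)⁻¹ * ∑ j ∈ Finset.range n, ∑ k, H j k)
      atTop (𝓝 0) := by
  have h1 := tendsto_finsetSum Finset.univ fun k _ => hM k
  rw [Finset.sum_const_zero] at h1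
  refine h1.congr' ?_
  filter_upwards [eventually_gt_atTop 0] with n hn
  have hn1 : (n : ℝ) ≠ 0 := by positivity
  rw [Finset.sum_comm, Finset.mul_sum, ← Finset.sum_sub_distrib]
  refine Finset.sum_congr rfl fun k _ => ?_
  rw [Finset.sum_sub_distrib, ← hτ]
  field_simp

theorem mul_eq_sum_sub_sum (n : ℕ) (k : Fin K) :
    (K : ℝ) * τ n k = ∑ l, τ n l - ∑ l, (τ n l - τ n k) := by
  rw [Finset.sum_sub_distrib]
  simp

theorem exists_pos_eventually_le (hK : 0 < K)
    (hτ : ∀ (n : ℕ) k, (n : ℝ) * τ n k = ∑ j ∈ Finset.range n, b j k)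
    (hM : ∀ k, Tendsto (fun n : ℕ => (∑ j ∈ Finset.range n, (b j k - H j k)) / n) atTop (𝓝 0))
    (hdiff : ∀ k l, Tendsto (fun n => τ n l - τ n k) atTop (𝓝 0))
    (hδ : 0 < δ) (hlow : ∀ n, δ ≤ ∑ k, H n k) :
    ∃ c > 0, ∀ᶠ n in atTop, ∀ k, c ≤ τ n k := by
  have hK' : (0 : ℝ) < K := by exact_mod_cast hK
  refine ⟨δ / (2 * K), by positivity, eventually_all.mpr fun k => ?_⟩
  have h1 := tendsto_sum_sub_average hτ hM
  have h2 := tendsto_finsetSum Finset.univ fun l (_ : l ∈ Finset.univ) => hdiff k l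
  rw [Finset.sum_const_zero] at h2
  have h3 := h1.sub h2
  rw [sub_zero] at h3
  filter_upwards [h3.eventually_const_lt (show -(δ / 2) < 0 by linarith),
    eventually_gt_atTop 0] with n hn hn0
  have hn1 : (0 : ℝ) < n := by exact_mod_cast hn0
  have h4 : δ ≤ (n : ℝ)⁻¹ * ∑ j ∈ Finset.range n, ∑ k, H j k := by
    have := Finset.card_nsmul_le_sum (Finset.range n) (fun j => ∑ k, H j k) δ
      fun j _ => hlow j
    rw [Finset.card_range, nsmul_eq_mul] at this
    rw [inv_mul_eq_div, le_div_iff₀ hn1]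
    linarith
  have h5 := mul_eq_sum_sub_sum (τ := τ) n k
  rw [div_le_iff₀ (by positivity)]
  linarith

theorem tendsto_div_of_sub {c : ℝ} (hc : 0 < c) (hlow : ∀ᶠ n in atTop, ∀ k, c ≤ τ n k)
    (hdiff : ∀ k l, Tendsto (fun n => τ n l - τ n k) atTop (𝓝 0)) (k l : Fin K) :
    Tendsto (fun n => τ n k / τ n l) atTop (𝓝 1) := by
  have h1 : Tendsto (fun n => (τ n k - τ n l) / τ n l) atTop (𝓝 0) := by
    have h2 := ((hdiff l k).abs).div_const c
    rw [abs_zero, zero_div] at h2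
    refine squeeze_zero_norm' ?_ h2
    filter_upwards [hlow] with n hn
    have := hn l
    rw [Real.norm_eq_abs, abs_div, abs_of_pos (hc.trans_le this)]
    gcongr
  have h3 := h1.add_const 1
  rw [zero_add] at h3
  refine h3.congr' ?_
  filter_upwards [hlow] with n hn
  have : τ n l ≠ 0 := (hc.trans_le (hn l)).ne'
  field_simp
  ring

theorem tendsto_of_tendsto_sum (hK : 0 < K)
    (hτ : ∀ (n : ℕ) k, (n : ℝ) * τ n k = ∑ j ∈ Finset.range n, b j k)
    (hM : ∀ k, Tendsto (fun n : ℕ => (∑ j ∈ Finset.range n, (b j k - H j k)) / n) atTop (𝓝 0))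
    (hdiff : ∀ k l, Tendsto (fun n => τ n l - τ n k) atTop (𝓝 0)) {G : ℝ}
    (hG : Tendsto (fun n => ∑ k, H n k) atTop (𝓝 G)) (k : Fin K) :
    Tendsto (fun n => τ n k) atTop (𝓝 (G / K)) := by
  have hK' : (K : ℝ) ≠ 0 := by positivity
  have h1 := (tendsto_sum_sub_average hτ hM).add hG.cesaro
  have h2 := tendsto_finsetSum Finset.univ fun l (_ : l ∈ Finset.univ) => hdiff k l
  rw [Finset.sum_const_zero] at h2
  have h3 := (h1.sub h2).div_const (K : ℝ)
  rw [zero_add, sub_zero] at h3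
  refine h3.congr fun n => ?_
  have h5 := mul_eq_sum_sub_sum (τ := τ) n k
  rw [sub_add_cancel, ← h5, mul_div_cancel_left₀ _ hK']

end Deterministic

/-! ### The throughput process -/

section Throughput

variable {Ω : Type*} {K : ℕ} {β : ℝ} {ν : Measure ℝ} {r : Fin K → ℝ} {R : ℕ → Fin K → Ω → ℝ}
  {ord : (Fin K → ℝ≥0∞) → Equiv.Perm (Fin K)}

/-- The rates in slot `n`, divided by the mean rates: these vectors are i.i.d. -/
def unitRates (r : Fin K → ℝ) (R : ℕ → Fin K → Ω → ℝ) (n : ℕ) (ω : Ω) (k : Fin K) : ℝ :=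
  R n k ω / r k

/-- The throughputs generated by the rates `R`. -/
abbrev rateThroughput (β : ℝ) (ν : Measure ℝ) (r : Fin K → ℝ)
    (ord : (Fin K → ℝ≥0∞) → Equiv.Perm (Fin K)) (R : ℕ → Fin K → Ω → ℝ) (n : ℕ) (ω : Ω) :
    Fin K → ℝ :=
  throughput β ν r ord (fun m i => R m i ω) n

theorem served_rates_eq (hr : ∀ k, 0 < r k) (n : ℕ) (ω : Ω) (t : Fin K → ℝ) (k : Fin K) :
    served β ν r ord t (fun i => R n i ω) k =
      r k * reward β ν r t (ord (normRate t r)) (unitRates r R n ω) k := by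
  rw [← served_eq]
  congr 1
  ext i
  rw [unitRates, mul_div_cancel₀ _ (hr i).ne']

theorem mul_throughput_div_eq_sum (hr : ∀ k, 0 < r k) (ω : Ω) (n : ℕ) (k : Fin K) :
    (n : ℝ) * (rateThroughput β ν r ord R n ω k / r k) =
      ∑ j ∈ Finset.range n, reward β ν r (rateThroughput β ν r ord R j ω)
        (ord (normRate (rateThroughput β ν r ord R j ω) r)) (unitRates r R (j + 1) ω) k := by
  induction n with
  | zero => simp
  | succ n ih =>
    have hrk := (hr k).ne'
    have hn : (n : ℝ) + 1 ≠ 0 := by positivity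
    rw [Finset.sum_range_succ, ← ih]
    simp only [rateThroughput, throughput]
    rw [served_rates_eq hr]
    push_cast
    field_simp

theorem throughput_nonneg (hK : 0 < K) (hβ1 : β ≤ 1) (hr : ∀ k, 0 < r k) {ω : Ω}
    (hω : ∀ n k, 0 ≤ unitRates r R n ω k) (n : ℕ) (k : Fin K) :
    0 ≤ rateThroughput β ν r ord R n ω k := by
  induction n with
  | zero => exact zero_le_one
  | succ n ih =>
    simp only [rateThroughput, throughput]
    rw [served_rates_eq hr]
    have h1 := reward_nonneg (β := β) (ν := ν) (r := r) (t := rateThroughput β ν r ord R n ω)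
      (π := ord (normRate (rateThroughput β ν r ord R n ω) r)) hK hβ1 (hω (n + 1)) k
    have h2 := (hr k).le
    have h3 : 0 ≤ throughput β ν r ord (fun m i => R m i ω) n k := ih
    positivity

theorem normRate_lt_of_div_lt {t : Fin K → ℝ} (hr : ∀ k, 0 < r k) (ht : ∀ k, 0 ≤ t k)
    {k l : Fin K} (h : t k / r k < t l / r l) : normRate t r l < normRate t r k := by
  have hrk := hr k
  have hrl := hr l
  have htl : 0 < t l := by
    by_contra hcon
    have h1 : t l = 0 := le_antisymm (not_lt.mp hcon) (ht l)
    rw [h1, zero_div] at h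
    exact absurd (div_nonneg (ht k) hrk.le) (not_le.mpr h)
  rw [normRate, normRate, ← ENNReal.ofReal_div_of_pos htl]
  rcases (ht k).eq_or_lt with h0 | h0
  · rw [← h0, ENNReal.ofReal_zero, ENNReal.div_zero (by simpa using hrk)]
    exact ENNReal.ofReal_lt_top
  · rw [← ENNReal.ofReal_div_of_pos h0, ENNReal.ofReal_lt_ofReal_iff (by positivity),
      div_lt_div_iff₀ htl h0]
    rw [div_lt_div_iff₀ hrk hrl] at h
    linarith

theorem probesInSlot_eq (hr : ∀ k, 0 < r k) (n : ℕ) (ω : Ω) :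
    probesInSlot β ν r ord (fun m i => R m i ω) n =
      firstStop (Stops β ν r (rateThroughput β ν r ord R n ω)
          (ord (normRate (rateThroughput β ν r ord R n ω) r)))
        (ord (normRate (rateThroughput β ν r ord R n ω) r))
        (normRate (rateThroughput β ν r ord R n ω) fun i => r i * unitRates r R (n + 1) ω i) := by
  rw [probesInSlot, numProbed_eq_firstStop]
  congr 2
  ext i
  rw [unitRates, mul_div_cancel₀ _ (hr i).ne']

theorem measurable_unitRates_of_le {n : ℕ} {m : MeasurableSpace Ω}
    (h : ∀ k, MeasurableSpace.comap (R n k) inferInstance ≤ m) :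
    Measurable[m] (unitRates r R n) := by
  refine @measurable_pi_lambda _ _ _ m _ _ fun k => ?_
  exact (measurable_iff_comap_le.mpr (h k)).div_const _

variable [m0 : MeasurableSpace Ω] {P : Measure Ω}

/-- The σ-algebras generated by the rates up to slot `n`. -/
def rateFiltration (hR : ∀ n k, Measurable (R n k)) : Filtration ℕ m0 where
  seq n := ⨆ p ∈ {p : ℕ × Fin K | p.1 ≤ n}, MeasurableSpace.comap (R p.1 p.2) inferInstance
  mono' _ _ hij := biSup_mono fun _ hp => le_trans hp hij
  le' _ := iSup₂_le fun p _ => (hR p.1 p.2).comap_le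

theorem measurable_unitRates_rateFiltration (hR : ∀ n k, Measurable (R n k)) (n : ℕ) :
    Measurable[rateFiltration hR n] (unitRates r R n) :=
  measurable_unitRates_of_le fun k =>
    le_iSup₂_of_le (f := fun (p : ℕ × Fin K) (_ : p ∈ {p : ℕ × Fin K | p.1 ≤ n}) =>
      MeasurableSpace.comap (R p.1 p.2) inferInstance) (n, k) (le_refl n) le_rfl

theorem HomogeneousRates.indep_unitRates (hA : HomogeneousRates P ν r R) (n : ℕ) :
    Indep (rateFiltration hA.measurable n)
      (MeasurableSpace.comap (unitRates r R (n + 1)) inferInstance) P := by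
  have h := indep_iSup_of_disjoint (m := fun p : ℕ × Fin K =>
    MeasurableSpace.comap (R p.1 p.2) inferInstance)
    (fun p => (hA.measurable p.1 p.2).comap_le) hA.indep
    (S := {p | p.1 ≤ n}) (T := {p | p.1 = n + 1}) (by
      rw [Set.disjoint_left]
      intro p hp hp'
      have h1 : p.1 ≤ n := hp
      have h2 : p.1 = n + 1 := hp'
      omega)
  refine indep_of_indep_of_le_right h (measurable_iff_comap_le.mp ?_)
  exact measurable_unitRates_of_le fun k =>
    le_iSup₂_of_le (f := fun (p : ℕ × Fin K) (_ : p ∈ {p : ℕ × Fin K | p.1 = n + 1}) =>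
      MeasurableSpace.comap (R p.1 p.2) inferInstance) (n + 1, k) rfl le_rfl

variable [IsProbabilityMeasure P]

theorem HomogeneousRates.map_unitRates (hA : HomogeneousRates P ν r R) (n : ℕ) :
    P.map (unitRates r R n) = Measure.pi fun _ : Fin K => ν := by
  have hm : ∀ k, Measurable fun ω => R n k ω / r k := fun k => (hA.measurable n k).div_const _
  have h1 : iIndepFun (fun (k : Fin K) ω => R n k ω / r k) P :=
    (hA.indep.precomp (g := fun k : Fin K => (n, k)) fun k l h => (Prod.ext_iff.mp h).2).comp
      (fun k x => x / r k) fun k => measurable_id.div_const _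
  have h2 := (iIndepFun_iff_map_fun_eq_pi_map fun k => (hm k).aemeasurable).mp h1
  refine h2.trans ?_
  congr 1
  ext1 k
  have h3 : (fun ω => R n k ω / r k) = (fun x => x / r k) ∘ R n k := rfl
  have hr := (hA.rate_pos k).ne'
  rw [h3, ← Measure.map_map (measurable_div_const (r k)) (hA.measurable n k), hA.law,
    Measure.map_map (measurable_div_const (r k)) (measurable_const_mul (r k))]
  have h4 : (fun x => x / r k) ∘ (fun x => r k * x) = id := by
    ext x
    simp [mul_div_cancel_left₀ _ hr]
  rw [h4, Measure.map_id]

variable [IsProbabilityMeasure ν]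

theorem measurable_throughput (hK : 0 < K) (hr : ∀ k, 0 < r k)
    (hR : ∀ n k, Measurable (R n k)) (hord : SortingRule ord) (n : ℕ) :
    Measurable[rateFiltration hR n] (rateThroughput β ν r ord R n) := by
  induction n with
  | zero => exact @measurable_const _ _ _ (rateFiltration hR 0) _
  | succ n ih =>
    refine @measurable_pi_lambda _ _ _ (rateFiltration hR (n + 1)) _ _ fun k => ?_
    have hT : Measurable[rateFiltration hR (n + 1)] (rateThroughput β ν r ord R n) :=
      ih.mono ((rateFiltration hR).mono n.le_succ) le_rfl
    have hp : Measurable[rateFiltration hR (n + 1)] fun ω =>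
        (rateThroughput β ν r ord R n ω, unitRates r R (n + 1) ω) :=
      hT.prodMk (measurable_unitRates_rateFiltration hR (n + 1))
    have hrew := (measurable_reward_ord (β := β) (ν := ν) (r := r) hK hord k).comp hp
    have hTk : Measurable[rateFiltration hR (n + 1)]
        fun ω => rateThroughput β ν r ord R n ω k := (measurable_pi_apply k).comp hT
    have e : (fun ω => rateThroughput β ν r ord R (n + 1) ω k) = fun ω =>
        ((n : ℝ) / ((n : ℝ) + 1)) * rateThroughput β ν r ord R n ω k +
        (1 / ((n : ℝ) + 1)) * (r k * reward β ν r (rateThroughput β ν r ord R n ω)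
          (ord (normRate (rateThroughput β ν r ord R n ω) r)) (unitRates r R (n + 1) ω) k) := by
      ext ω
      simp only [rateThroughput, throughput]
      rw [served_rates_eq hr]
    rw [e]
    exact (hTk.const_mul _).add ((hrew.const_mul _).const_mul _)

theorem HomogeneousRates.ae_unitRates_nonneg (hA : HomogeneousRates P ν r R) :
    ∀ᵐ ω ∂P, ∀ n k, 0 ≤ unitRates r R n ω k := by
  rw [ae_all_iff]
  intro n
  have hm : Measurable (unitRates r R n) :=
    (measurable_unitRates_rateFiltration hA.measurable n).mono
      ((rateFiltration hA.measurable).le n) le_rfl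
  refine ae_of_ae_map hm.aemeasurable (p := fun x : Fin K → ℝ => ∀ k, 0 ≤ x k) ?_
  rw [hA.map_unitRates]
  exact ae_pi_nonneg hA.nonneg

/-- The conditional mean of the normalized service of user `k` at throughputs `t`. -/
def meanReward (β : ℝ) (ν : Measure ℝ) (r : Fin K → ℝ)
    (ord : (Fin K → ℝ≥0∞) → Equiv.Perm (Fin K)) (t : Fin K → ℝ) (k : Fin K) : ℝ :=
  ∫ x, reward β ν r t (ord (normRate t r)) x k ∂(Measure.pi fun _ : Fin K => ν)

theorem HomogeneousRates.ae_tendsto_noise (hA : HomogeneousRates P ν r R) (hK : 0 < K)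
    (hβ0 : 0 < β) (hβ1 : β ≤ 1) (hord : SortingRule ord) :
    ∀ᵐ ω ∂P, ∀ k, Tendsto (fun n : ℕ => (∑ j ∈ Finset.range n,
      (reward β ν r (rateThroughput β ν r ord R j ω)
        (ord (normRate (rateThroughput β ν r ord R j ω) r)) (unitRates r R (j + 1) ω) k -
      meanReward β ν r ord (rateThroughput β ν r ord R j ω) k)) / n) atTop (𝓝 0) := by
  rw [ae_all_iff]
  intro k
  exact ae_tendsto_average_sub_integral (rateFiltration hA.measurable)
    (U := rateThroughput β ν r ord R) (V := unitRates r R)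
    (measurable_throughput hK hA.rate_pos hA.measurable hord)
    (measurable_unitRates_rateFiltration hA.measurable) hA.indep_unitRates
    (fun n => hA.map_unitRates (n + 1))
    (φ := fun t x => reward β ν r t (ord (normRate t r)) x k)
    (measurable_reward_ord hK hord k) (D := fun x => |x k|)
    (measurable_pi_apply k).abs (integrable_abs_apply hA.integrable k)
    fun _ _ => abs_reward_le hK hβ0 hβ1 k

/-- Almost surely the normalized throughputs are eventually positive and asymptotically equal. -/
theorem HomogeneousRates.ae_ratio (hA : HomogeneousRates P ν r R) (hK : 0 < K)
    (hβ0 : 0 < β) (hβ1 : β < 1) (hord : SortingRule ord) :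
    ∀ᵐ ω ∂P, (∀ k l, Tendsto (fun n => rateThroughput β ν r ord R n ω l / r l -
        rateThroughput β ν r ord R n ω k / r k) atTop (𝓝 0)) ∧
      (∀ᶠ n in atTop, ∀ k, 0 < rateThroughput β ν r ord R n ω k) ∧
      ∀ k l, Tendsto (fun n => (rateThroughput β ν r ord R n ω k / r k) /
        (rateThroughput β ν r ord R n ω l / r l)) atTop (𝓝 1) := by
  obtain ⟨δ, hδ0, hδ⟩ := exists_pos_le_one_sub K β
  filter_upwards [hA.ae_tendsto_noise hK hβ0 hβ1.le hord, hA.ae_unitRates_nonneg] with ω hM hpos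
  have hr := hA.rate_pos
  have hdiff := tendsto_sub_of_drift
    (τ := fun n k => rateThroughput β ν r ord R n ω k / r k)
    (fun n k => mul_throughput_div_eq_sum hr ω n k) hM
    (fun n k => abs_integral_reward_le hK hβ0 hβ1.le hA.nonneg hA.integrable hA.mean _ k)
    (fun n k l hkl => integral_reward_le hK hβ0 hβ1.le hr hA.nonneg hA.integrable
      (hord.antitone _)
      (normRate_lt_of_div_lt hr (throughput_nonneg hK hβ1.le hr hpos n) hkl))
  obtain ⟨c, hc, hlow⟩ := exists_pos_eventually_le hK
    (τ := fun n k => rateThroughput β ν r ord R n ω k / r k)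
    (fun n k => mul_throughput_div_eq_sum hr ω n k) hM hdiff hδ0
    (fun n => le_sum_integral_reward hK hβ0 hβ1 hr hA.nonneg hA.integrable hA.mean
      (hord.antitone _) hδ0 hδ)
  refine ⟨hdiff, ?_, tendsto_div_of_sub hc hlow hdiff⟩
  filter_upwards [hlow] with n hn k
  have h1 := hc.trans_le (hn k)
  exact (div_pos_iff_of_pos_right (hr k)).mp h1

/-- Almost sure convergence of the throughputs, with `κ` the mean service of the threshold rule
divided by the number of users. -/
theorem HomogeneousRates.ae_tendsto_throughput (hA : HomogeneousRates P ν r R) (hK : 0 < K)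
    (hβ0 : 0 < β) (hβ1 : β < 1) (hord : SortingRule ord) {v : ℕ → ℝ}
    (hv : IsThreshold K β ν v) (hν : ∀ j ∈ Finset.Icc 1 (Jmax K β), ν {v j} = 0) :
    ∀ᵐ ω ∂P, ∀ k, Tendsto (fun n => rateThroughput β ν r ord R n ω k / r k) atTop
      (𝓝 ((∫ x, thresholdGain β (Jmax K β) v (Equiv.refl _) x
        ∂(Measure.pi fun _ : Fin K => ν)) / K)) := by
  filter_upwards [hA.ae_tendsto_noise hK hβ0 hβ1.le hord, hA.ae_ratio hK hβ0 hβ1 hord]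
    with ω hM hω
  obtain ⟨hdiff, hpos, hratio⟩ := hω
  exact tendsto_of_tendsto_sum hK (τ := fun n k => rateThroughput β ν r ord R n ω k / r k)
    (fun n k => mul_throughput_div_eq_sum hA.rate_pos ω n k) hM hdiff
    (tendsto_sum_integral_reward hK hβ0 hβ1.le hA.nonneg hA.integrable hv hν hA.rate_pos hpos
      hratio fun n => ord (normRate (rateThroughput β ν r ord R n ω) r))

theorem HomogeneousRates.tendsto_probesInSlot (hA : HomogeneousRates P ν r R) (hK : 0 < K)
    (hβ0 : 0 < β) (hβ1 : β < 1) (hord : SortingRule ord) {v : ℕ → ℝ}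
    (hv : IsThreshold K β ν v) (hν : ∀ j ∈ Finset.Icc 1 (Jmax K β), ν {v j} = 0) {j : ℕ}
    (hj : j ∈ Finset.Icc 1 (Jmax K β)) :
    Tendsto (fun n => P.real {ω | probesInSlot β ν r ord (fun m i => R m i ω) n = j}) atTop
      (𝓝 (probeProb ν v j)) := by
  set ψ : (Fin K → ℝ) → (Fin K → ℝ) → ℝ := fun t x =>
    if firstStop (Stops β ν r t (ord (normRate t r))) (ord (normRate t r))
      (normRate t fun i => r i * x i) = j then 1 else 0 with hψ
  have hψm : Measurable (Function.uncurry ψ) :=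
    Measurable.ite ((measurable_firstStop_ord (β := β) (ν := ν) (r := r) hK hord)
      (measurableSet_singleton j)) measurable_const measurable_const
  have hψb : ∀ t x, ‖ψ t x‖ ≤ 1 := fun t x => by
    simp only [hψ]
    split_ifs <;> simp
  have hT : ∀ n, Measurable (rateThroughput β ν r ord R n) := fun n =>
    (measurable_throughput hK hA.rate_pos hA.measurable hord n).mono
      ((rateFiltration hA.measurable).le n) le_rfl
  have hV : ∀ n, Measurable (unitRates r R n) := fun n =>
    (measurable_unitRates_rateFiltration hA.measurable n).mono
      ((rateFiltration hA.measurable).le n) le_rfl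
  have hψTV : ∀ n, Measurable fun ω =>
      ψ (rateThroughput β ν r ord R n ω) (unitRates r R (n + 1) ω) := fun n => by
    have h := hψm.comp ((hT n).prodMk (hV (n + 1)))
    exact h
  have hprob : ∀ n, P.real {ω | probesInSlot β ν r ord (fun m i => R m i ω) n = j} =
      ∫ ω, ∫ x, ψ (rateThroughput β ν r ord R n ω) x ∂(Measure.pi fun _ : Fin K => ν) ∂P := by
    intro n
    have hset : MeasurableSet {ω | probesInSlot β ν r ord (fun m i => R m i ω) n = j} := by
      have h1 := ((measurable_firstStop_ord (β := β) (ν := ν) (r := r) hK hord).comp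
        ((hT n).prodMk (hV (n + 1)))) (measurableSet_singleton j)
      convert h1 using 1
      ext ω
      rw [Set.mem_ofPred_eq, probesInSlot_eq hA.rate_pos]
      rfl
    rw [← hA.map_unitRates (n + 1), ← integral_comp_of_indep
      ((rateFiltration hA.measurable).le n)
      (measurable_throughput hK hA.rate_pos hA.measurable hord n) (hV (n + 1))
      (hA.indep_unitRates n) hψm
      (Integrable.of_bound (hψTV n).aestronglyMeasurable 1 (Eventually.of_forall fun ω => hψb _ _)),
      ← integral_indicator_one hset]
    congr 1
    ext ω
    simp only [Set.indicator, Set.mem_ofPred_eq, probesInSlot_eq hA.rate_pos, hψ, Pi.one_apply]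
  simp_rw [hprob]
  rw [← integral_thresholdStop_eq hβ0 hA.nonneg hA.integrable hv hν hj]
  set q := ∫ x, (if thresholdStop (Jmax K β) v (Equiv.refl _) x = j then (1 : ℝ) else 0)
    ∂(Measure.pi fun _ : Fin K => ν)
  have hq : ∫ _ω, q ∂P = q := by simp
  rw [← hq]
  refine tendsto_integral_of_dominated_convergence (fun _ => 1) (fun n => ?_)
    (integrable_const _) (fun n => Eventually.of_forall fun ω => ?_) ?_
  · have h1 : Measurable fun t => ∫ x, ψ t x ∂(Measure.pi fun _ : Fin K => ν) :=
      hψm.stronglyMeasurable.integral_prod_right.measurable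
    exact (h1.comp (hT n)).aestronglyMeasurable
  · have := norm_integral_le_of_norm_le_const (μ := Measure.pi fun _ : Fin K => ν)
      (f := ψ (rateThroughput β ν r ord R n ω)) (C := 1)
      (Eventually.of_forall fun x => hψb _ x)
    simpa using this
  · filter_upwards [hA.ae_ratio hK hβ0 hβ1 hord] with ω hω
    exact tendsto_integral_firstStop hK hβ0 hβ1.le hA.nonneg hA.integrable hv hν hA.rate_pos
      hω.2.1 hω.2.2 (fun n => ord (normRate (rateThroughput β ν r ord R n ω) r)) j

end Throughput

/-! ### Probes that use up the whole slot -/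

section FullProbe

variable {K : ℕ} {ν : Measure ℝ} {r : Fin K → ℝ} {t : Fin K → ℝ} {π : Equiv.Perm (Fin K)}

theorem Jmax_one (hK : 0 < K) : Jmax K 1 = 1 := by
  simp only [Jmax, div_one, Nat.floor_one]
  omega

theorem firstStop_one (hK : 0 < K) (s : Fin K → ℝ≥0∞) :
    firstStop (Stops 1 ν r t π) π s = 1 :=
  le_antisymm (firstStop_le le_rfl (stops_of_one_le (by norm_num) _)) (one_le_firstStop hK s)

theorem reward_one (hK : 0 < K) (x : Fin K → ℝ) (k : Fin K) : reward 1 ν r t π x k = 0 := by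
  simp [reward, firstStop_one hK]

theorem probeProb_one [IsProbabilityMeasure ν] (hK : 0 < K) (h0 : ∀ᵐ x ∂ν, 0 ≤ x)
    {v : ℕ → ℝ} (hv : IsThreshold K 1 ν v) (hν : ν {v 1} = 0) : probeProb ν v 1 = 1 := by
  have h1 : v 1 = 0 := by
    have := hv.2
    rwa [Jmax_one hK] at this
  rw [h1] at hν
  have h2 : cdf ν 0 = 0 := by
    rw [← measureReal_Iio_of_null hν, measureReal_def]
    have : ν (Set.Iio 0) = 0 := by
      rw [ae_iff] at h0
      simpa [Set.Iio] using h0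
    rw [this, ENNReal.toReal_zero]
  simp [probeProb, h1, h2]

end FullProbe

end JPSPF

end

theorem theorem4 {Ω : Type*} [MeasurableSpace Ω] (P : Measure Ω) [IsProbabilityMeasure P]
    (K : ℕ) (hK : 0 < K) (β : ℝ) (hβ0 : 0 < β) (hβ1 : β ≤ 1)
    (ν : Measure ℝ) [IsProbabilityMeasure ν] (r : Fin K → ℝ) (R : ℕ → Fin K → Ω → ℝ)
    (hA1 : JPSPF.HomogeneousRates P ν r R)
    (ord : (Fin K → ℝ≥0∞) → Equiv.Perm (Fin K)) (hord : JPSPF.SortingRule ord) :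
    (∀ j < JPSPF.Jmax K β, ∃! v : ℝ, v = JPSPF.g β ν j v) ∧
    ∀ v : ℕ → ℝ, JPSPF.IsThreshold K β ν v →
      (∀ j ∈ Finset.Icc 1 (JPSPF.Jmax K β), ν {v j} = 0) →
      (∃ κ : ℝ,
        (∀ᵐ ω ∂P, ∀ k : Fin K,
          Tendsto (fun n : ℕ => JPSPF.throughput β ν r ord (fun m i => R m i ω) n k / r k)
            atTop (𝓝 κ)) ∧
        κ * (K : ℝ) =
          ∑ j ∈ Finset.Icc 1 (JPSPF.Jmax K β),
            JPSPF.probeProb ν v j * (1 - (j : ℝ) * β) * JPSPF.truncMaxMean ν v j) ∧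
      (∀ j ∈ Finset.Icc 1 (JPSPF.Jmax K β),
        Tendsto
          (fun n : ℕ => P.real {ω | JPSPF.probesInSlot β ν r ord (fun m i => R m i ω) n = j})
          atTop (𝓝 (JPSPF.probeProb ν v j))) := by
  have hK' : (K : ℝ) ≠ 0 := by positivity
  refine ⟨fun j hj => JPSPF.existsUnique_eq_g hβ0 hA1.integrable hj, fun v hv hν => ?_⟩
  rcases hβ1.lt_or_eq with hβ | rfl
  · refine ⟨⟨_, hA1.ae_tendsto_throughput hK hβ0 hβ hord hv hν, ?_⟩,
      fun j hj => hA1.tendsto_probesInSlot hK hβ0 hβ hord hv hν hj⟩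
    rw [div_mul_cancel₀ _ hK']
    exact JPSPF.integral_thresholdGain_eq hK hβ0 hβ1 hA1.nonneg hA1.integrable hv hν
  · -- each slot is spent on a single probe and nothing is transmitted
    rw [JPSPF.Jmax_one hK] at hν ⊢
    refine ⟨⟨0, Eventually.of_forall fun ω k => ?_, by simp⟩, fun j hj => ?_⟩
    · refine tendsto_const_nhds.congr' ?_
      filter_upwards [eventually_gt_atTop 0] with n hn
      have hn' : (n : ℝ) ≠ 0 := by positivity
      have h := JPSPF.mul_throughput_div_eq_sum (β := 1) (ν := ν) (ord := ord) (R := R)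
        hA1.rate_pos ω n k
      simp only [JPSPF.reward_one hK, Finset.sum_const_zero] at h
      exact ((mul_eq_zero.mp h).resolve_left hn').symm
    · obtain rfl : j = 1 := by simpa using hj
      rw [JPSPF.probeProb_one hK hA1.nonneg hv (hν 1 hj)]
      refine tendsto_const_nhds.congr fun n => ?_
      simp [JPSPF.probesInSlot, JPSPF.numProbed_eq_firstStop, JPSPF.firstStop_one hK]
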